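/- **Groups.** Let $N_{\mathbb Z,2}$ be the quotient of the free nilpotent group of step $2$ on generators $b_i$, $i\in\mathbb Z$, by the relations $b_i^2=e$, and let $G_{\mathbb Z,\mathrm{Nil},2}=N_{\mathbb Z,2}\rtimes\mathbb Z$, where the generator $z_0$ of $\mathbb Z$ acts by $b_i\mapsto b_{i+1}$. Put $b_{i,j}=[b_i,b_j]$. For $D\subset\mathbb N$, let $G_{D,2}$ be the quotient of $G_{\mathbb Z,\mathrm{Nil},2}$ by the normal subgroup generated by all $b_{i,j}$ with $i-j\in D$. For a sequence $\mathbf k=(k_j)_{j\ge 1}$ of positive integers, let $G_{D,2,\mathbf k}$ be the quotient of $G_{D,2}$ by the image of the normal subgroup generated by the relations $b_{i,i+j}=b_{i+k_j,\,i+j+k_j}$ ($i\in\mathbb Z$, $j\ge1$). **Følner functions.** For a group $G$ with finite generating set $S$ and a finite set $V\subset G$, let $\partial_S V$ be the set of $v\in V$ at distance $1$ from $G\setminus V$ in the (left-invariant) word metric. For $n\ge1$ let $\text{Føl}_{G,S}(n)$ be the least cardinality of a non-empty finite $V$ with $\#\partial_SV/\#V\le 1/n$. For real functions of a positive integer, write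 $f\preceq g$ if there are constants $C,K>0$ ($K$ an integer) with $f(n)\le C\,g(Kn)$ for all $n\ge1$, and $f\simeq g$ if $f\preceq g$ and $g\preceq f$. **Statement.** (i) For $D\subset\mathbb N$ put $\rho_D(n)=\#([1,n]\setminus D)$. For every $D$ and every finite generating set $S$ of $G_{D,2}$, $$\text{Føl}_{G_{D,2},S}(n)\simeq\exp(n\rho_D(n)+n).$$ Moreover, for every non-decreasing $\rho:\{1,2,\dots\}\to[0,\infty)$ with $\rho(n+1)-\rho(n)\le1$ for all $n\ge 1$, there is $D\subset\mathbb N$ such that $\text{Føl}_{G_{D,2},S}(n)\simeq\exp(n\rho(n)+n)$ for every finite generating set $S$ of $G_{D,2}$. (ii) For real $x\ge0$ put $\tau_{D,\mathbf k}(x)=\sum_{1\le j\le x,\ j\notin D}\min\{k_j,x\}$. There is an absolute constant $C>0$ such that for all $D\subset\mathbb N$ and all $\mathbf k$, the Følner function of $G_{D,2,\mathbf k}$ with respect to the generating set $\{b_0,z_0\}$ satisfies $$\exp\big(Cn+C\tau_{D,\mathbf k}(Cn)\big)\le\text{Føl}(n)\ \ (n\ge2),\qquad \text{Føl}(n)\le\exp\big(4n+2\tau_{D,\mathbf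 k}(2n)\big)\ \ (n\ge1).$$ Moreover, for every non-decreasing $\tau:\{1,2,\dots\}\to\mathbb R$ with $\tau(n+1)-\tau(n)\le n$ for all $n\ge1$, there are $D\subset\mathbb N$ and $\mathbf k$ such that $n+\tau(n)\simeq\log\text{Føl}_{G_{D,2,\mathbf k},S}(n)$ for every finite generating set $S$ of $G_{D,2,\mathbf k}$. -/

import Mathlib

namespace NilByCyclic

open scoped commutatorElement

noncomputable section

/-! ### Følner functions and asymptotic equivalence -/

section Folner

variable {G : Type*} [Group G]

open Classical in
/-- The boundary of a finite set `V` in a group with generating set `S`: the elements of `V` at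
distance one, in the (left-invariant) word metric of `S`, from the complement of `V`. -/
def boundary (S : Set G) (V : Finset G) : Finset G :=
  V.filter fun v => ∃ s ∈ S, v * s ∉ V ∨ v * s⁻¹ ∉ V

/-- The least cardinality of a non-empty finite set `V` with `#∂V / #V ≤ ε`
(the value is `0` if, and only if, there is no such set). -/
def minFolner (S : Set G) (ε : ℝ) : ℕ :=
  sInf {m : ℕ | ∃ V : Finset G, V.Nonempty ∧
    ((boundary S V).card : ℝ) / (V.card : ℝ) ≤ ε ∧ V.card = m}

/-- The Følner function of `G` with respect to `S`. -/
def Fol (S : Set G) (n : ℕ) : ℕ := minFolner S (1 / (n : ℝ))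

end Folner

/-- `f ≼ g`: there are constants `C, K > 0` with `f n ≤ C * g (K * n)` for all positive
integers `n`. -/
def AsympLE (f g : ℕ → ℝ) : Prop :=
  ∃ C : ℝ, ∃ K : ℕ, 0 < C ∧ 0 < K ∧ ∀ n : ℕ, 1 ≤ n → f n ≤ C * g (K * n)

/-- Asymptotic equivalence `f ≃ g`. -/
def AsympEquiv (f g : ℕ → ℝ) : Prop := AsympLE f g ∧ AsympLE g f

/-! ### The step-2 nilpotent group on `b i`, `i ∈ ℤ` -/

/-- The free nilpotent group of step two on generators indexed by `ℤ`
(the term with index `2` of the series is `[[F, F], F]`). -/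
abbrev FreeNil2 : Type := FreeGroup ℤ ⧸ (⊤ : Subgroup (FreeGroup ℤ)).lowerCentralSeries 2

/-- The free generators of `FreeNil2`. -/
def freeGen (i : ℤ) : FreeNil2 := QuotientGroup.mk (FreeGroup.of i)

/-- The normal subgroup generated by the squares of the generators. -/
abbrev squares : Subgroup FreeNil2 :=
  Subgroup.normalClosure (Set.range fun i : ℤ => freeGen i ^ 2)

/-- The free step-two nilpotent group on involutions `b i`, `i ∈ ℤ`. -/
abbrev N2 : Type := FreeNil2 ⧸ squares

/-- The generators of `N2`. -/
def b (i : ℤ) : N2 := QuotientGroup.mk (freeGen i)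

/-- The index shift on the free nilpotent group. -/
def freeShift : FreeNil2 ≃* FreeNil2 :=
  QuotientGroup.congr _ _ (FreeGroup.freeGroupCongr (Equiv.addRight (1 : ℤ)))
    (Subgroup.characteristic_iff_map_eq.mp inferInstance _)

theorem freeShift_freeGen (i : ℤ) : freeShift (freeGen i) = freeGen (i + 1) := by
  change QuotientGroup.mk (FreeGroup.freeGroupCongr (Equiv.addRight (1 : ℤ)) (FreeGroup.of i)) = _
  simp [freeGen]

theorem map_squares : squares.map (freeShift : FreeNil2 →* FreeNil2) = squares := by
  rw [Subgroup.map_normalClosure _ (freeShift : FreeNil2 →* FreeNil2) (MulEquiv.surjective freeShift)]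
  congr 1
  ext x
  constructor
  · rintro ⟨_, ⟨i, rfl⟩, rfl⟩
    exact ⟨i + 1, by simp [freeShift_freeGen]⟩
  · rintro ⟨i, rfl⟩
    exact ⟨_, ⟨i - 1, rfl⟩, by simp [freeShift_freeGen]⟩

/-- The index shift as an automorphism of `N2`. -/
def shift : MulAut N2 := QuotientGroup.congr squares squares freeShift map_squares

theorem shift_b (i : ℤ) : shift (b i) = b (i + 1) := by
  change QuotientGroup.mk (freeShift (freeGen i)) = _
  rw [freeShift_freeGen]
  rfl

/-- The action of `ℤ` on `N2`: the element `m` acts by the `m`-th power of the shift. -/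
def shiftAction : Multiplicative ℤ →* MulAut N2 := zpowersHom (MulAut N2) shift

theorem shiftAction_b (m i : ℤ) : shiftAction (Multiplicative.ofAdd m) (b i) = b (i + m) := by
  have hinv : ∀ j : ℤ, shift⁻¹ (b j) = b (j - 1) := fun j => by
    rw [MulAut.inv_apply, MulEquiv.symm_apply_eq, shift_b, sub_add_cancel]
  change (shift ^ m) (b i) = b (i + m)
  induction m using Int.induction_on generalizing i with
  | zero => simp
  | succ n ih => rw [zpow_add_one, MulAut.mul_apply, shift_b, ih]; congr 1; ring
  | pred n ih => rw [zpow_sub_one, MulAut.mul_apply, hinv, ih]; congr 1; ring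

/-! ### The groups -/

/-- The extension of `N2` by `ℤ` acting by shifts. -/
abbrev GNil2 : Type := N2 ⋊[shiftAction] Multiplicative ℤ

/-- The commutator `[b i, b j]` in `GNil2`. -/
def comm (i j : ℤ) : GNil2 := SemidirectProduct.inl ⁅b i, b j⁆

/-- The normal subgroup generated by the `[b i, b j]`, `i - j ∈ D`. -/
abbrev BD (D : Set ℕ) : Subgroup GNil2 :=
  Subgroup.normalClosure {g | ∃ i j : ℤ, ∃ d ∈ D, i - j = (d : ℤ) ∧ g = comm i j}

/-- The group `G_{D,2}`. -/
abbrev GD (D : Set ℕ) : Type := GNil2 ⧸ BD D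

/-- The normal subgroup that imposes the relations
`[b i, b (i + j)] = [b (i + k j), b (i + j + k j)]` for `i ∈ ℤ` and `j ≥ 1`. -/
abbrev periodic (k : ℕ → ℕ+) : Subgroup GNil2 :=
  Subgroup.normalClosure {g | ∃ i : ℤ, ∃ j : ℕ, 1 ≤ j ∧
    g = comm i (i + j) * (comm (i + (k j : ℕ)) (i + j + (k j : ℕ)))⁻¹}

/-- The image of `periodic k` in `G_{D,2}`. -/
abbrev periodicImage (D : Set ℕ) (k : ℕ → ℕ+) : Subgroup (GD D) :=
  (periodic k).map (QuotientGroup.mk' (BD D))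

instance (D : Set ℕ) (k : ℕ → ℕ+) : (periodicImage D k).Normal :=
  Subgroup.Normal.map inferInstance _ (QuotientGroup.mk'_surjective _)

/-- The group `G_{D,2,k}`. -/
abbrev GDk (D : Set ℕ) (k : ℕ → ℕ+) : Type := GD D ⧸ periodicImage D k

/-- The projection of `GNil2` onto `G_{D,2,k}`. -/
def projDk (D : Set ℕ) (k : ℕ → ℕ+) : GNil2 →* GDk D k :=
  (QuotientGroup.mk' (periodicImage D k)).comp (QuotientGroup.mk' (BD D))

/-- The generating set `{b 0, z 0}` of `G_{D,2,k}`, where `z 0` is the generator of `ℤ`. -/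
def stdGen (D : Set ℕ) (k : ℕ → ℕ+) : Set (GDk D k) :=
  {projDk D k (SemidirectProduct.inl (b 0)),
   projDk D k (SemidirectProduct.inr (Multiplicative.ofAdd 1))}

/-! ### The counting functions -/

open Classical in
/-- `ρ_D(n)`, the cardinality of `[1, n] ∖ D`. -/
def rho (D : Set ℕ) (n : ℕ) : ℕ := ((Finset.Icc 1 n).filter (· ∉ D)).card

open Classical in
/-- `τ_{D,k}(x)`, the sum of `min (k j) x` over the integers `j ∉ D` with `1 ≤ j ≤ x`. -/
def tau (D : Set ℕ) (k : ℕ → ℕ+) (x : ℝ) : ℝ :=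
  ∑ j ∈ (Finset.Icc 1 ⌊x⌋₊).filter (· ∉ D), min ((k j : ℕ) : ℝ) x

end

end NilByCyclic

namespace NilByCyclic

open scoped commutatorElement

noncomputable section

/-! ### Translates of a finite set and changes of generating sets -/

section Exits

variable {G : Type*} [Group G]

/-! Both families are quotients `π` of `GNil2` in which `[b i, b (i + j)]` dies for `j ∈ D` and is
`κ j`-periodic in `i`, with `κ j = 0` meaning no period. Let `P L` be the cardinality of `pairs D κ
L`, the number of independent commutators with `1 ≤ j ≤ L` and `0 ≤ i < L`. It is `L * rho D L` for
`GD D` and `tau D k L` for `GDk D k`. Everything rests on `log Fol n` being comparable to `L + P L`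
for `L` proportional to `n`.

Upper bound (`IsShiftQuotient.exists_isFolnerSet`): with `L = 2 * n`, the group `A` generated by `b
0, …, b (L - 1)` has order at most `2 ^ (P L + L)`. The set of all `a * z ^ m` with `a ∈ A` and `0 ≤
m < L` has its boundary in the layers `m = 0` and `m = L - 1`, a proportion `2 / L = 1 / n`.

Lower bound (`IsShiftQuotient.mul_log_two_le`): the `b i` with `i < L` and the commutators counted
by `P L` have word length `O(L)`, so each moves at most half of a Følner set `V` out of `V` once `n
≥ 32 * L`. An action of `Q` on configurations over `ZMod 2` attaches to each such element a
coordinate that, within its family, it alone flips. Thus `V` behaves like a subset of a discrete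
cube with many internal edges, and the edge-isoperimetric inequality
(`sum_card_filter_mul_log_two_le`) makes `V` exponentially large.

For the realizations, round the prescribed function down to integers: `D` collects the indices
without growth, and the periods are the increments elsewhere. -/

open Classical in
/-- The elements of `V` that right multiplication by `g` moves out of `V`. -/
def exits (V : Finset G) (g : G) : Finset G := V.filter fun v => v * g ∉ V

theorem mem_exits {V : Finset G} {g v : G} : v ∈ exits V g ↔ v ∈ V ∧ v * g ∉ V := by
  simp [exits]

theorem mem_boundary {S : Set G} {V : Finset G} {v : G} :
    v ∈ boundary S V ↔ v ∈ V ∧ ∃ s ∈ S, v * s ∉ V ∨ v * s⁻¹ ∉ V := by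
  simp [boundary]

theorem card_exits_one (V : Finset G) : (exits V 1).card = 0 := by
  rw [Finset.card_eq_zero, Finset.eq_empty_iff_forall_notMem]
  intro v hv
  rw [mem_exits, mul_one] at hv
  exact hv.2 hv.1

/-- A point leaving under `g * h` leaves at the first step, or its translate by `g` leaves at the
second. Hence exits grow at most linearly in word length. -/
theorem card_exits_mul (V : Finset G) (g h : G) :
    (exits V (g * h)).card ≤ (exits V g).card + (exits V h).card := by
  classical
  have hsub : exits V (g * h) ⊆ exits V g ∪ (exits V h).image (fun v : G => v * g⁻¹) := by
    intro v hv
    rw [mem_exits] at hv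
    rw [Finset.mem_union, Finset.mem_image]
    by_cases hg : v * g ∈ V
    · exact Or.inr ⟨v * g, mem_exits.2 ⟨hg, by rw [mul_assoc]; exact hv.2⟩, by group⟩
    · exact Or.inl (mem_exits.2 ⟨hv.1, hg⟩)
  refine (Finset.card_le_card hsub).trans ((Finset.card_union_le _ _).trans ?_)
  exact Nat.add_le_add_left Finset.card_image_le _

/-- Translation by `g` is a bijection from the points that `g` keeps in `V` to those that `g⁻¹`
keeps. -/
theorem card_exits_inv (V : Finset G) (g : G) : (exits V g⁻¹).card = (exits V g).card := by
  classical
  have key : ∀ g : G, (exits V g).card + (V.filter fun v => v * g ∈ V).card = V.card := fun g => by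
    rw [add_comm, exits]
    exact Finset.card_filter_add_card_filter_not _
  have h : (V.filter fun v => v * g ∈ V).card = (V.filter fun v => v * g⁻¹ ∈ V).card := by
    refine Finset.card_bij (fun (v : G) _ => v * g) ?_ ?_ ?_
    · intro v hv
      rw [Finset.mem_filter] at hv ⊢
      exact ⟨hv.2, by simpa using hv.1⟩
    · intro v _ w _ hvw
      exact mul_right_cancel hvw
    · intro w hw
      rw [Finset.mem_filter] at hw
      exact ⟨w * g⁻¹, Finset.mem_filter.2 ⟨hw.2, by simpa using hw.1⟩, by group⟩
  have h1 := key g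
  have h2 := key g⁻¹
  omega

theorem card_exits_pow (V : Finset G) (g : G) (m : ℕ) :
    (exits V (g ^ m)).card ≤ m * (exits V g).card := by
  induction m with
  | zero => simp [card_exits_one]
  | succ m ih =>
    rw [pow_succ, add_mul, one_mul]
    exact (card_exits_mul V _ _).trans (by gcongr)

theorem card_exits_le_boundary {S : Set G} (V : Finset G) {s : G} (hs : s ∈ S) :
    (exits V s).card ≤ (boundary S V).card := by
  refine Finset.card_le_card fun v hv => ?_
  rw [mem_exits] at hv
  exact mem_boundary.2 ⟨hv.1, s, hs, Or.inl hv.2⟩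

theorem exists_card_exits_le {S : Set G} {g : G} (hg : g ∈ Subgroup.closure S) :
    ∃ l : ℕ, ∀ V : Finset G, (exits V g).card ≤ l * (boundary S V).card := by
  induction hg using Subgroup.closure_induction with
  | mem s hs => exact ⟨1, fun V => by simpa using card_exits_le_boundary V hs⟩
  | one => exact ⟨0, fun V => by simp [card_exits_one]⟩
  | mul g h _ _ hg hh =>
    obtain ⟨l, hl⟩ := hg
    obtain ⟨m, hm⟩ := hh
    refine ⟨l + m, fun V => (card_exits_mul V g h).trans ?_⟩
    rw [add_mul]
    exact add_le_add (hl V) (hm V)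
  | inv g _ hg =>
    obtain ⟨l, hl⟩ := hg
    exact ⟨l, fun V => by rw [card_exits_inv]; exact hl V⟩

theorem card_boundary_le_sum {S : Set G} (hS : S.Finite) (V : Finset G) :
    (boundary S V).card ≤ ∑ s ∈ hS.toFinset, 2 * (exits V s).card := by
  classical
  have hsub : boundary S V ⊆ hS.toFinset.biUnion fun s => exits V s ∪ exits V s⁻¹ := by
    intro v hv
    obtain ⟨hv, s, hs, h⟩ := mem_boundary.1 hv
    rw [Finset.mem_biUnion]
    refine ⟨s, hS.mem_toFinset.2 hs, Finset.mem_union.2 ?_⟩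
    exact h.imp (fun h => mem_exits.2 ⟨hv, h⟩) (fun h => mem_exits.2 ⟨hv, h⟩)
  refine (Finset.card_le_card hsub).trans (Finset.card_biUnion_le.trans ?_)
  refine Finset.sum_le_sum fun s _ => (Finset.card_union_le _ _).trans ?_
  rw [card_exits_inv, two_mul]

/-- Boundaries with respect to two finite generating sets are comparable. -/
theorem exists_card_boundary_le {S T : Set G} (hS : S.Finite) (hT : Subgroup.closure T = ⊤) :
    ∃ L : ℕ, 0 < L ∧
      ∀ V : Finset G, (boundary S V).card ≤ L * (boundary T V).card := by
  have h : ∀ s : G, ∃ l : ℕ, ∀ V : Finset G, (exits V s).card ≤ l * (boundary T V).card :=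
    fun s => exists_card_exits_le (by rw [hT]; exact Subgroup.mem_top s)
  choose l hl using h
  refine ⟨∑ s ∈ hS.toFinset, 2 * l s + 1, Nat.succ_pos _, fun V => ?_⟩
  refine (card_boundary_le_sum hS V).trans ?_
  calc ∑ s ∈ hS.toFinset, 2 * (exits V s).card
      ≤ ∑ s ∈ hS.toFinset, 2 * l s * (boundary T V).card :=
        Finset.sum_le_sum fun s _ => by rw [mul_assoc]; exact Nat.mul_le_mul_left 2 (hl s V)
    _ = (∑ s ∈ hS.toFinset, 2 * l s) * (boundary T V).card := by rw [Finset.sum_mul]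
    _ ≤ _ := Nat.mul_le_mul_right _ (Nat.le_succ _)

/-- A set `V` with `#∂V / #V ≤ 1 / n`. -/
def IsFolnerSet (S : Set G) (n : ℕ) (V : Finset G) : Prop :=
  V.Nonempty ∧ n * (boundary S V).card ≤ V.card

theorem isFolnerSet_iff {S : Set G} {n : ℕ} (hn : 1 ≤ n) {V : Finset G} :
    IsFolnerSet S n V ↔
      V.Nonempty ∧ ((boundary S V).card : ℝ) / (V.card : ℝ) ≤ 1 / (n : ℝ) := by
  refine and_congr_right fun hV => ?_
  have hV' : (0 : ℝ) < V.card := by exact_mod_cast hV.card_pos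
  have hn' : (0 : ℝ) < n := by exact_mod_cast hn
  rw [div_le_div_iff₀ hV' hn', one_mul, mul_comm]
  norm_cast

theorem Fol_le_card {S : Set G} {n : ℕ} (hn : 1 ≤ n) {V : Finset G} (hV : IsFolnerSet S n V) :
    Fol S n ≤ V.card := by
  obtain ⟨h1, h2⟩ := (isFolnerSet_iff hn).1 hV
  exact Nat.sInf_le ⟨V, h1, h2, rfl⟩

theorem exists_isFolnerSet_card_eq_Fol {S : Set G} {n : ℕ} (hn : 1 ≤ n)
    (h : ∃ V, IsFolnerSet S n V) : ∃ V, IsFolnerSet S n V ∧ V.card = Fol S n := by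
  obtain ⟨V, hV⟩ := h
  obtain ⟨h1, h2⟩ := (isFolnerSet_iff hn).1 hV
  have hne : {m : ℕ | ∃ V : Finset G, V.Nonempty ∧
    ((boundary S V).card : ℝ) / (V.card : ℝ) ≤ 1 / (n : ℝ) ∧ V.card = m}.Nonempty :=
    ⟨V.card, V, h1, h2, rfl⟩
  obtain ⟨W, hW1, hW2, hW3⟩ := Nat.sInf_mem hne
  exact ⟨W, (isFolnerSet_iff hn).2 ⟨hW1, hW2⟩, hW3⟩

theorem IsFolnerSet.of_boundary_le {S T : Set G} {L n : ℕ} {V : Finset G}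
    (hL : (boundary S V).card ≤ L * (boundary T V).card) (hV : IsFolnerSet T (L * n) V) :
    IsFolnerSet S n V := by
  refine ⟨hV.1, le_trans ?_ hV.2⟩
  calc n * (boundary S V).card ≤ n * (L * (boundary T V).card) := Nat.mul_le_mul_left n hL
    _ = _ := by ring

/-- Existence of Følner sets is carried along because otherwise the infimum defining `Fol` takes the
default value `0`. The existence for `S` permits a second use with the roles of `S` and `T`
exchanged. -/
theorem exists_Fol_le_Fol {S T : Set G} (hS : S.Finite) (hT : Subgroup.closure T = ⊤)
    (hF : ∀ n, 1 ≤ n → ∃ V, IsFolnerSet T n V) :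
    ∃ L : ℕ, 0 < L ∧ ∀ n, 1 ≤ n → Fol S n ≤ Fol T (L * n) ∧ ∃ V, IsFolnerSet S n V := by
  obtain ⟨L, hL, h⟩ := exists_card_boundary_le hS hT
  refine ⟨L, hL, fun n hn => ?_⟩
  have hLn : 1 ≤ L * n := Nat.mul_pos hL hn
  obtain ⟨V, hV, hc⟩ := exists_isFolnerSet_card_eq_Fol hLn (hF _ hLn)
  have hV' := hV.of_boundary_le (h V)
  exact ⟨hc ▸ Fol_le_card hn hV', V, hV'⟩

end Exits

/-! ### An edge-isoperimetric inequality for cube-like graphs -/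

/-- For `a ≤ b`, add `log (2 * a) ≤ log (a + b)` with weight `a` and `log b ≤ log (a + b)` with
weight `b`. This is the inductive step of the isoperimetric inequality. -/
theorem two_mul_min_mul_log_two_add_le (a b : ℕ) :
    ((2 * min a b : ℕ) : ℝ) * Real.log 2 + 2 * a * Real.log a + 2 * b * Real.log b ≤
      2 * ((a + b : ℕ) : ℝ) * Real.log ((a + b : ℕ) : ℝ) := by
  wlog hab : a ≤ b generalizing a b
  · have := this b a (le_of_not_ge hab)
    rw [min_comm, add_comm b a] at this
    linarith
  rw [min_eq_left hab]
  rcases Nat.eq_zero_or_pos a with rfl | ha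
  · simp
  have ha' : (0 : ℝ) < a := by exact_mod_cast ha
  have hab' : (a : ℝ) ≤ b := by exact_mod_cast hab
  have hb' : (0 : ℝ) < b := ha'.trans_le hab'
  have h1 : Real.log 2 + Real.log a ≤ Real.log (a + b) := by
    rw [← Real.log_mul two_ne_zero ha'.ne']
    exact Real.log_le_log (by positivity) (by linarith)
  have h2 : Real.log b ≤ Real.log (a + b) := Real.log_le_log hb' (by linarith)
  have h3 := mul_le_mul_of_nonneg_left h1 ha'.le
  have h4 := mul_le_mul_of_nonneg_left h2 hb'.le
  push_cast
  linarith

/-- If each injective map `σ i` switches the colour `φ i` and preserves the other colours, then a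
finite set `U` contains few pairs `x, σ i x`, as in a discrete cube. -/
theorem sum_card_filter_mul_log_two_le {X ι : Type*} [DecidableEq X] [DecidableEq ι]
    (σ : ι → X → X)
    (φ : ι → X → Prop) (I : Finset ι) (hσ : ∀ i ∈ I, Function.Injective (σ i))
    (hflip : ∀ i ∈ I, ∀ x, φ i (σ i x) ↔ ¬ φ i x)
    (hfix : ∀ i ∈ I, ∀ j ∈ I, i ≠ j → ∀ x, φ j (σ i x) ↔ φ j x) (U : Finset X) :
    ((∑ i ∈ I, (U.filter fun u => σ i u ∈ U).card : ℕ) : ℝ) * Real.log 2 ≤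
      2 * U.card * Real.log U.card := by
  classical
  induction I using Finset.induction_on generalizing U with
  | empty =>
    simp only [Finset.sum_empty, Nat.cast_zero, zero_mul]
    exact mul_nonneg (by positivity) (Real.log_natCast_nonneg _)
  | insert i I hi ih =>
    have ih := ih (fun j hj => hσ j (Finset.mem_insert_of_mem hj))
      (fun j hj => hflip j (Finset.mem_insert_of_mem hj))
      (fun j hj k hk => hfix j (Finset.mem_insert_of_mem hj) k (Finset.mem_insert_of_mem hk))
    -- Halve `U` by the colour `i`: the other maps preserve each half, while `σ i` exchanges the
    -- colours and so contributes at most `2 * min #A #B`.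
    set A := U.filter (φ i) with hA
    set B := U.filter (fun u => ¬ φ i u) with hB
    have hcard : A.card + B.card = U.card := Finset.card_filter_add_card_filter_not _
    have hi' := Finset.mem_insert_self i I
    have hsplit : ∀ j ∈ I, (U.filter fun u => σ j u ∈ U).card =
        (A.filter fun u => σ j u ∈ A).card + (B.filter fun u => σ j u ∈ B).card := by
      intro j hj
      rw [← Finset.card_filter_add_card_filter_not (s := U.filter fun u => σ j u ∈ U) (φ i)]
      have hji := hfix j (Finset.mem_insert_of_mem hj) i hi' (fun h => hi (h ▸ hj))
      congr 2
      · ext u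
        simp only [hA, Finset.mem_filter, hji]
        tauto
      · ext u
        simp only [hB, Finset.mem_filter, hji]
        tauto
    have hcross : (U.filter fun u => σ i u ∈ U).card ≤ 2 * min A.card B.card := by
      rw [← Finset.card_filter_add_card_filter_not (s := U.filter fun u => σ i u ∈ U) (φ i)]
      have hf := hflip i hi'
      have hinj := hσ i hi'
      have e1 : ((U.filter fun u => σ i u ∈ U).filter (φ i)).card ≤ min A.card B.card := by
        refine le_min (Finset.card_le_card fun u hu => ?_)
          (Finset.card_le_card_of_injOn (σ i) (fun u hu => ?_) hinj.injOn)
        · simp only [hA, Finset.mem_filter] at hu ⊢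
          exact ⟨hu.1.1, hu.2⟩
        · simp only [hB, Finset.mem_coe, Finset.mem_filter, hf] at hu ⊢
          exact ⟨hu.1.2, not_not.2 hu.2⟩
      have e2 : ((U.filter fun u => σ i u ∈ U).filter fun u => ¬ φ i u).card ≤
          min A.card B.card := by
        refine le_min (Finset.card_le_card_of_injOn (σ i) (fun u hu => ?_) hinj.injOn)
          (Finset.card_le_card fun u hu => ?_)
        · simp only [hA, Finset.mem_coe, Finset.mem_filter, hf] at hu ⊢
          exact ⟨hu.1.2, hu.2⟩
        · simp only [hB, Finset.mem_filter] at hu ⊢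
          exact ⟨hu.1.1, hu.2⟩
      omega
    rw [Finset.sum_insert hi, Finset.sum_congr rfl hsplit, Finset.sum_add_distrib, ← hcard]
    have hlog : 0 ≤ Real.log 2 := Real.log_nonneg one_le_two
    have h1 := ih A
    have h2 := ih B
    have h3 := two_mul_min_mul_log_two_add_le A.card B.card
    have h4 : (((U.filter fun u => σ i u ∈ U).card : ℕ) : ℝ) * Real.log 2 ≤
        ((2 * min A.card B.card : ℕ) : ℝ) * Real.log 2 :=
      mul_le_mul_of_nonneg_right (by exact_mod_cast hcross) hlog
    rw [Nat.cast_add, Nat.cast_add, add_mul, add_mul]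
    linarith

/-- A finite set that is nearly invariant under many elements with independent colours
is exponentially large in the number of these elements. -/
theorem card_mul_log_two_le_four_mul_log_card {G ι : Type*} [Group G] (t : ι → G)
    (φ : ι → G → Prop) (I : Finset ι)
    (hflip : ∀ i ∈ I, ∀ x, φ i (x * t i) ↔ ¬ φ i x)
    (hfix : ∀ i ∈ I, ∀ j ∈ I, i ≠ j → ∀ x, φ j (x * t i) ↔ φ j x) {V : Finset G}
    (hV : V.Nonempty) (hexit : ∀ i ∈ I, 2 * (exits V (t i)).card ≤ V.card) :
    (I.card : ℝ) * Real.log 2 ≤ 4 * Real.log V.card := by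
  classical
  have h := sum_card_filter_mul_log_two_le (fun i x => x * t i) φ I
    (fun i _ => mul_left_injective (t i)) hflip hfix V
  have hstay : ∀ i ∈ I, V.card ≤ 2 * (V.filter fun v => v * t i ∈ V).card := by
    intro i hi
    have h1 := hexit i hi
    have h2 : (V.filter fun v => v * t i ∈ V).card + (exits V (t i)).card = V.card :=
      Finset.card_filter_add_card_filter_not _
    omega
  -- The final `4` is this `2`, from half of `V` staying, times the `2` of the edge bound.
  have hsum : I.card * V.card ≤ 2 * ∑ i ∈ I, (V.filter fun v => v * t i ∈ V).card := by
    rw [Finset.mul_sum, ← smul_eq_mul, ← Finset.sum_const]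
    exact Finset.sum_le_sum hstay
  have hsum' : (I.card : ℝ) * V.card ≤
      2 * ((∑ i ∈ I, (V.filter fun v => v * t i ∈ V).card : ℕ) : ℝ) := by exact_mod_cast hsum
  have hlog : 0 ≤ Real.log 2 := Real.log_nonneg one_le_two
  have hpos : (0 : ℝ) < V.card := by exact_mod_cast hV.card_pos
  have := mul_le_mul_of_nonneg_right hsum' hlog
  refine le_of_mul_le_mul_right ?_ hpos
  linarith

/-! ### A permutation model -/

section Model

variable (D : Set ℕ) (κ : ℕ → ℕ)

/-- Configurations: the first component records the exponents of the generators `b r`, the second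
one the exponents of the commutators `[b r, b (r + j)]`. -/
abbrev Config : Type := (ℤ → ZMod 2) × (ℕ → ℤ → ZMod 2)

open Classical in
/-- The contribution to the commutator coordinates of moving `b i` past `x`. The period `κ j` of
the commutators `[b r, b (r + j)]` is infinite if `κ j = 0`. -/
def pairing (i : ℤ) : (ℤ → ZMod 2) →+ (ℕ → ℤ → ZMod 2) where
  toFun x j r := if 1 ≤ j ∧ j ∉ D ∧ (κ j : ℤ) ∣ r - i then x (i + j) else 0
  map_zero' := by ext; simp
  map_add' x y := by
    ext j r
    simp only [Pi.add_apply]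
    split_ifs <;> simp

open Classical in
theorem pairing_apply (i : ℤ) (x : ℤ → ZMod 2) (j : ℕ) (r : ℤ) :
    pairing D κ i x j r = if 1 ≤ j ∧ j ∉ D ∧ (κ j : ℤ) ∣ r - i then x (i + j) else 0 := rfl

theorem pairing_single_self (i : ℤ) : pairing D κ i (Pi.single i 1) = 0 := by
  ext j r
  rw [pairing_apply]
  split_ifs with h
  · rw [Pi.single_apply, if_neg (by omega)]
    rfl
  · rfl

theorem add_self_config {A : Type*} (x : A → ZMod 2) : x + x = 0 := by
  ext a
  exact CharTwo.add_self_eq_zero _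

theorem add_self_config₂ {A B : Type*} (x : A → B → ZMod 2) : x + x = 0 := by
  ext a b
  exact CharTwo.add_self_eq_zero _

/-- The action of `b i` on configurations. -/
def toggle (i : ℤ) : Equiv.Perm Config :=
  Function.Involutive.toPerm
    (fun p => (p.1 + Pi.single i 1, p.2 + pairing D κ i p.1)) (by
      rintro ⟨x, c⟩
      simp only [map_add, pairing_single_self, add_zero]
      rw [add_assoc, add_assoc, add_self_config, add_self_config₂, add_zero, add_zero])

theorem toggle_apply (i : ℤ) (p : Config) :
    toggle D κ i p = (p.1 + Pi.single i 1, p.2 + pairing D κ i p.1) := rfl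

theorem toggle_inv (i : ℤ) : (toggle D κ i)⁻¹ = toggle D κ i :=
  rfl

/-- The action of the free group on configurations. -/
def freeAction : FreeGroup ℤ →* Equiv.Perm Config := FreeGroup.lift (toggle D κ)

/-- Triangular affine maps of this form are closed under composition. They form a Heisenberg-like
group, which is why the action has nilpotency step two. -/
theorem exists_freeAction_eq (w : FreeGroup ℤ) :
    ∃ (a : ℤ → ZMod 2) (L : (ℤ → ZMod 2) →+ (ℕ → ℤ → ZMod 2)) (c : ℕ → ℤ → ZMod 2),
      ∀ p, freeAction D κ w p = (p.1 + a, p.2 + L p.1 + c) := by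
  induction w using FreeGroup.induction_on with
  | C1 => exact ⟨0, 0, 0, fun p => by simp⟩
  | of i => exact ⟨Pi.single i 1, pairing D κ i, 0, fun p => by simp [freeAction, toggle_apply]⟩
  | inv_of i _ =>
    exact ⟨Pi.single i 1, pairing D κ i, 0, fun p => by
      simp [freeAction, toggle_inv, toggle_apply]⟩
  | mul v w hv hw =>
    obtain ⟨a, L, c, h⟩ := hv
    obtain ⟨a', L', c', h'⟩ := hw
    refine ⟨a' + a, L + L', c' + L a' + c, fun p => ?_⟩
    rw [map_mul, Equiv.Perm.mul_apply, h', h]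
    simp only [map_add, AddMonoidHom.add_apply, Prod.mk.injEq]
    exact ⟨by abel, by abel⟩

theorem exists_freeAction_commutator (v w : FreeGroup ℤ) :
    ∃ c : ℕ → ℤ → ZMod 2, ∀ p, freeAction D κ ⁅v, w⁆ p = (p.1, p.2 + c) := by
  obtain ⟨a, L, c, h⟩ := exists_freeAction_eq D κ v
  obtain ⟨a', L', c', h'⟩ := exists_freeAction_eq D κ w
  refine ⟨L a' - L' a, fun p => ?_⟩
  -- Since `⁅v, w⁆ * (w * v) = v * w`, writing the point as an image under `w * v` avoids formulas
  -- for inverses.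
  obtain ⟨q, rfl⟩ := (freeAction D κ (w * v)).surjective p
  rw [← Equiv.Perm.mul_apply, ← map_mul, commutatorElement_def,
    show v * w * v⁻¹ * w⁻¹ * (w * v) = v * w by group, map_mul, map_mul, Equiv.Perm.mul_apply,
    Equiv.Perm.mul_apply, h, h', h, h']
  simp only [map_add, Prod.mk.injEq]
  exact ⟨by abel, by abel⟩

theorem commute_freeAction_commutator (u v w : FreeGroup ℤ) :
    Commute (freeAction D κ u) (freeAction D κ ⁅v, w⁆) := by
  obtain ⟨c, h⟩ := exists_freeAction_commutator D κ v w
  obtain ⟨a, L, d, h'⟩ := exists_freeAction_eq D κ u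
  ext1 p
  rw [Equiv.Perm.mul_apply, Equiv.Perm.mul_apply, h, h', h', h]
  simp only [Prod.mk.injEq, true_and]
  abel

theorem lowerCentralSeries_two_le_ker :
    (⊤ : Subgroup (FreeGroup ℤ)).lowerCentralSeries 2 ≤ (freeAction D κ).ker := by
  have h1 : (⊤ : Subgroup (FreeGroup ℤ)).lowerCentralSeries 1 ≤
      (Subgroup.centralizer (Set.range (freeAction D κ))).comap (freeAction D κ) := by
    rw [Subgroup.lowerCentralSeries_succ, Subgroup.lowerCentralSeries_zero, Subgroup.commutator_le]
    intro v _ w _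
    rw [Subgroup.mem_comap, Subgroup.mem_centralizer_iff]
    rintro _ ⟨u, rfl⟩
    exact commute_freeAction_commutator D κ u v w
  rw [Subgroup.lowerCentralSeries_succ, Subgroup.commutator_le]
  intro v hv w _
  rw [MonoidHom.mem_ker, map_commutatorElement, commutatorElement_eq_one_iff_mul_comm]
  exact ((Subgroup.mem_centralizer_iff.1 (Subgroup.mem_comap.1 (h1 hv))) _ ⟨w, rfl⟩).symm

/-- The action of the free step-two nilpotent group. -/
def freeNilAction : FreeNil2 →* Equiv.Perm Config :=
  QuotientGroup.lift _ (freeAction D κ) (lowerCentralSeries_two_le_ker D κ)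

theorem freeNilAction_freeGen (i : ℤ) : freeNilAction D κ (freeGen i) = toggle D κ i := by
  change freeAction D κ (FreeGroup.of i) = _
  simp [freeAction]

/-- The action of `N2`. -/
def nilAction : N2 →* Equiv.Perm Config :=
  QuotientGroup.lift _ (freeNilAction D κ) (by
    refine Subgroup.normalClosure_le_normal ?_
    rintro _ ⟨i, rfl⟩
    rw [SetLike.mem_coe, MonoidHom.mem_ker, map_pow, freeNilAction_freeGen, sq,
      mul_eq_one_iff_eq_inv, toggle_inv])

theorem nilAction_b (i : ℤ) : nilAction D κ (b i) = toggle D κ i :=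
  freeNilAction_freeGen D κ i

theorem N2.hom_ext {H : Type*} [Group H] {f g : N2 →* H} (h : ∀ i, f (b i) = g (b i)) :
    f = g := by
  refine QuotientGroup.monoidHom_ext _ (QuotientGroup.monoidHom_ext _ ?_)
  ext i
  exact h i

/-- The index shift on configurations. -/
def slide : Multiplicative ℤ →* Equiv.Perm Config where
  toFun m :=
    { toFun p := (fun r => p.1 (r - m.toAdd), fun j r => p.2 j (r - m.toAdd))
      invFun p := (fun r => p.1 (r + m.toAdd), fun j r => p.2 j (r + m.toAdd))
      left_inv p := by simp
      right_inv p := by simp }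
  map_one' := by ext1 p; simp
  map_mul' m n := by
    ext1 p
    simp only [Equiv.coe_fn_mk, Equiv.Perm.mul_apply, toAdd_mul, Prod.mk.injEq]
    refine ⟨?_, ?_⟩
    · ext r
      rw [sub_sub]
    · ext j r
      rw [sub_sub]

theorem slide_apply (m : Multiplicative ℤ) (p : Config) :
    slide m p = (fun r => p.1 (r - m.toAdd), fun j r => p.2 j (r - m.toAdd)) := rfl

theorem slide_mul_toggle (m : Multiplicative ℤ) (i : ℤ) :
    slide m * toggle D κ i = toggle D κ (i + m.toAdd) * slide m := by
  ext1 p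
  simp only [Equiv.Perm.mul_apply, slide_apply, toggle_apply, Prod.mk.injEq]
  refine ⟨?_, ?_⟩
  · ext r
    simp only [Pi.add_apply, Pi.single_apply, sub_eq_iff_eq_add]
  · ext j r
    have h1 : r - (i + m.toAdd) = r - m.toAdd - i := by rw [sub_sub, add_comm]
    have h2 : i + m.toAdd + j - m.toAdd = i + j := by ring
    rw [Pi.add_apply, Pi.add_apply, Pi.add_apply, Pi.add_apply, pairing_apply, pairing_apply, h1, h2]

/-- The action of `GNil2` on configurations. -/
def action : GNil2 →* Equiv.Perm Config :=
  SemidirectProduct.lift (nilAction D κ) slide (by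
    intro m
    refine N2.hom_ext fun i => ?_
    change nilAction D κ (shiftAction (Multiplicative.ofAdd m.toAdd) (b i)) =
      slide m * nilAction D κ (b i) * (slide m)⁻¹
    rw [shiftAction_b, nilAction_b, nilAction_b, slide_mul_toggle, mul_inv_cancel_right])

theorem action_b (i : ℤ) : action D κ (SemidirectProduct.inl (b i)) = toggle D κ i := by
  rw [action, SemidirectProduct.lift_inl, nilAction_b]

/-- Each generator acts twice, so the terms depending on `p` cancel in characteristic two and a
fixed translation is left. -/
theorem action_comm (i l : ℤ) (p : Config) :
    action D κ (comm i l) p =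
      (p.1, p.2 + pairing D κ i (Pi.single l 1) + pairing D κ l (Pi.single i 1)) := by
  rw [comm, map_commutatorElement, map_commutatorElement, action_b, action_b, commutatorElement_def,
    toggle_inv, toggle_inv]
  simp only [Equiv.Perm.mul_apply, toggle_apply, map_add, pairing_single_self, add_zero,
    Prod.mk.injEq]
  have h1 := add_self_config (Pi.single i 1 : ℤ → ZMod 2)
  have h2 := add_self_config (Pi.single l 1 : ℤ → ZMod 2)
  have h3 := add_self_config₂ (pairing D κ l p.1)
  have h4 := add_self_config₂ (pairing D κ i p.1)
  have h5 := add_self_config₂ (pairing D κ i (Pi.single l 1))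
  refine ⟨?_, ?_⟩
  · calc _ = p.1 + (Pi.single i 1 + Pi.single i 1) + (Pi.single l 1 + Pi.single l 1) := by abel
      _ = _ := by rw [h1, h2, add_zero, add_zero]
  · calc _ = p.2 + pairing D κ i (Pi.single l 1) + pairing D κ l (Pi.single i 1)
          + (pairing D κ l p.1 + pairing D κ l p.1)
          + (pairing D κ i p.1 + pairing D κ i p.1)
          + (pairing D κ i (Pi.single l 1) + pairing D κ i (Pi.single l 1)) := by abel
      _ = _ := by rw [h3, h4, h5, add_zero, add_zero, add_zero]

open Classical in
/-- The commutator coordinates of `[b i, b (i + j)]`. -/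
theorem pairing_add_pairing_apply {i : ℤ} {j : ℕ} (hj : 1 ≤ j) (j' : ℕ) (r : ℤ) :
    (pairing D κ i (Pi.single (i + j) 1) + pairing D κ (i + j) (Pi.single i 1)) j' r =
      if j' = j ∧ j ∉ D ∧ (κ j : ℤ) ∣ r - i then 1 else 0 := by
  -- `pairing` only reads entries to the right, so only one order of the two generators contributes.
  have h2 : pairing D κ (i + j) (Pi.single i 1) j' r = 0 := by
    rw [pairing_apply, Pi.single_apply, if_neg (by omega : ¬ (i + j + j' : ℤ) = i), ite_self]
  rw [Pi.add_apply, Pi.add_apply, h2, add_zero, pairing_apply, Pi.single_apply, ← ite_and]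
  refine if_congr ⟨?_, ?_⟩ rfl rfl
  · rintro ⟨⟨_, h, h'⟩, e⟩
    have e : j' = j := by omega
    subst e
    exact ⟨rfl, h, h'⟩
  · rintro ⟨rfl, h, h'⟩
    exact ⟨⟨hj, h, h'⟩, rfl⟩

/-! ### The defining relations hold in the model -/

theorem action_comm_self (i : ℤ) : action D κ (comm i i) = 1 := by
  rw [comm, commutatorElement_self, map_one, map_one]

theorem action_comm_of_mem {i : ℤ} {j : ℕ} (hj : 1 ≤ j) (hD : j ∈ D) :
    action D κ (comm i (i + j)) = 1 := by
  ext1 p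
  rw [action_comm, add_assoc, show pairing D κ i (Pi.single (i + j) 1) +
    pairing D κ (i + j) (Pi.single i 1) = 0 from ?_, add_zero]
  · rfl
  · ext j' r
    rw [pairing_add_pairing_apply D κ hj, if_neg (by tauto)]
    rfl

open Classical in
theorem action_comm_add_period {i : ℤ} {j : ℕ} (hj : 1 ≤ j) :
    action D κ (comm (i + κ j) (i + j + κ j)) = action D κ (comm i (i + j)) := by
  ext1 p
  rw [add_right_comm i, action_comm, action_comm, add_assoc p.2, add_assoc p.2]
  refine Prod.ext rfl (congrArg (p.2 + ·) ?_)
  ext j' r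
  rw [pairing_add_pairing_apply D κ hj, pairing_add_pairing_apply D κ hj]
  have h : (κ j : ℤ) ∣ r - (i + κ j) ↔ (κ j : ℤ) ∣ r - i := by
    rw [← sub_sub, dvd_sub_self_right]
  exact if_congr (and_congr_right fun _ => and_congr_right fun _ => h) rfl rfl

theorem comm_swap (i l : ℤ) : comm l i = (comm i l)⁻¹ := by
  rw [comm, comm, ← map_inv, commutatorElement_inv]

theorem BD_le_ker_action : BD D ≤ (action D κ).ker := by
  refine Subgroup.normalClosure_le_normal ?_
  rintro _ ⟨i, l, d, hd, h, rfl⟩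
  -- The relations of `BD D` put the larger index first, the model the smaller one. The value `d =
  -- 0` is allowed in `D` and is harmless.
  rw [SetLike.mem_coe, MonoidHom.mem_ker, comm_swap, map_inv, inv_eq_one]
  obtain rfl : i = l + d := by omega
  rcases Nat.eq_zero_or_pos d with rfl | hd'
  · rw [Nat.cast_zero, add_zero, action_comm_self]
  · exact action_comm_of_mem D κ hd' hd

theorem periodic_le_ker_action (k : ℕ → ℕ+) :
    periodic k ≤ (action D fun j => (k j : ℕ)).ker := by
  refine Subgroup.normalClosure_le_normal ?_
  rintro _ ⟨i, j, hj, rfl⟩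
  rw [SetLike.mem_coe, MonoidHom.mem_ker, map_mul, map_inv, mul_inv_eq_one]
  exact (action_comm_add_period D (fun j => (k j : ℕ)) hj).symm

theorem rightHom_comm (i l : ℤ) : SemidirectProduct.rightHom (comm i l) = 1 :=
  SemidirectProduct.rightHom_inl _

theorem BD_le_ker_rightHom : BD D ≤ (SemidirectProduct.rightHom : GNil2 →* _).ker := by
  refine Subgroup.normalClosure_le_normal ?_
  rintro _ ⟨i, l, d, hd, h, rfl⟩
  exact rightHom_comm i l

theorem periodic_le_ker_rightHom (k : ℕ → ℕ+) :
    periodic k ≤ (SemidirectProduct.rightHom : GNil2 →* _).ker := by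
  refine Subgroup.normalClosure_le_normal ?_
  rintro _ ⟨i, j, hj, rfl⟩
  rw [SetLike.mem_coe, MonoidHom.mem_ker, map_mul, map_inv, rightHom_comm, rightHom_comm, inv_one, mul_one]

end Model

/-! ### Quotients of `GNil2` by shift-invariant relations between commutators -/

/-- `π` is a quotient map of `GNil2` in which the commutators `[b i, b (i + j)]` vanish for `j ∈ D`
and are `κ j`-periodic in `i`, and that is still compatible with the permutation model. -/
structure IsShiftQuotient (D : Set ℕ) (κ : ℕ → ℕ) {Q : Type*} [Group Q] (π : GNil2 →* Q) :
    Prop where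
  surjective : Function.Surjective π
  comm_eq_one : ∀ (i : ℤ) (j : ℕ), 1 ≤ j → j ∈ D → π (comm i (i + j)) = 1
  comm_period : ∀ (i : ℤ) (j : ℕ), 1 ≤ j →
    π (comm (i + κ j) (i + j + κ j)) = π (comm i (i + j))
  ker_le_action : π.ker ≤ (action D κ).ker
  ker_le_rightHom : π.ker ≤ (SemidirectProduct.rightHom : GNil2 →* _).ker

/-- The image of the standard generating set. -/
def gens {Q : Type*} [Group Q] (π : GNil2 →* Q) : Set Q :=
  {π (SemidirectProduct.inl (b 0)), π (SemidirectProduct.inr (Multiplicative.ofAdd 1))}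

open Classical in
/-- Pairs `(j, r)` that index the independent commutators `[b r, b (r + j)]` with
`1 ≤ j ≤ L` and `0 ≤ r < L`. -/
def pairs (D : Set ℕ) (κ : ℕ → ℕ) (L : ℕ) : Finset (ℕ × ℕ) :=
  (Finset.Icc 1 L ×ˢ Finset.range L).filter fun p => p.1 ∉ D ∧ (κ p.1 = 0 ∨ p.2 < κ p.1)

theorem mem_pairs {D : Set ℕ} {κ : ℕ → ℕ} {L : ℕ} {p : ℕ × ℕ} :
    p ∈ pairs D κ L ↔
      (1 ≤ p.1 ∧ p.1 ≤ L) ∧ p.2 < L ∧ p.1 ∉ D ∧ (κ p.1 = 0 ∨ p.2 < κ p.1) := by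
  simp only [pairs, Finset.mem_filter, Finset.mem_product, Finset.mem_Icc, Finset.mem_range,
    and_assoc]

/-! ### Relations in `GNil2` -/

theorem inl_b_eq (i : ℤ) : (SemidirectProduct.inl (b i) : GNil2) =
    SemidirectProduct.inr (Multiplicative.ofAdd i) * SemidirectProduct.inl (b 0) *
      SemidirectProduct.inr (Multiplicative.ofAdd i)⁻¹ := by
  rw [← SemidirectProduct.inl_aut, shiftAction_b, zero_add]

theorem inr_natCast (m : ℕ) : (SemidirectProduct.inr (Multiplicative.ofAdd (m : ℤ)) : GNil2) =
    SemidirectProduct.inr (Multiplicative.ofAdd 1) ^ m := by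
  rw [← map_pow, ← ofAdd_nsmul]
  simp

theorem inl_b_natCast (m : ℕ) : (SemidirectProduct.inl (b m) : GNil2) =
    SemidirectProduct.inr (Multiplicative.ofAdd 1) ^ m * SemidirectProduct.inl (b 0) *
      (SemidirectProduct.inr (Multiplicative.ofAdd 1) ^ m)⁻¹ := by
  rw [inl_b_eq, map_inv, inr_natCast]

theorem b_mul_self (i : ℤ) : b i * b i = 1 := by
  have h : freeGen i ^ 2 ∈ squares := Subgroup.subset_normalClosure ⟨i, rfl⟩
  have h' := (QuotientGroup.eq_one_iff (N := squares) _).2 h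
  rw [sq] at h'
  exact h'

theorem commute_commutator (x y z : N2) : Commute ⁅x, y⁆ z := by
  obtain ⟨x, rfl⟩ := QuotientGroup.mk_surjective x
  obtain ⟨y, rfl⟩ := QuotientGroup.mk_surjective y
  obtain ⟨z, rfl⟩ := QuotientGroup.mk_surjective z
  obtain ⟨x, rfl⟩ := QuotientGroup.mk_surjective x
  obtain ⟨y, rfl⟩ := QuotientGroup.mk_surjective y
  obtain ⟨z, rfl⟩ := QuotientGroup.mk_surjective z
  have h : ⁅⁅x, y⁆, z⁆ ∈ (⊤ : Subgroup (FreeGroup ℤ)).lowerCentralSeries 2 :=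
    Subgroup.commutator_mem_commutator
      (Subgroup.commutator_mem_commutator (Subgroup.mem_top x) (Subgroup.mem_top y))
      (Subgroup.mem_top z)
  have h' := (QuotientGroup.eq_one_iff
    (N := (⊤ : Subgroup (FreeGroup ℤ)).lowerCentralSeries 2) _).2 h
  rw [← commutatorElement_eq_one_iff_commute]
  exact congrArg (QuotientGroup.mk : FreeNil2 → N2) h'

theorem commute_comm_inl (i l : ℤ) (x : N2) : Commute (comm i l) (SemidirectProduct.inl x) :=
  (commute_commutator (b i) (b l) x).map SemidirectProduct.inl

/-- Conjugation by the involution `b i` inverts `[b i, b l]`, but it also fixes it, because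
commutators are central in `N2`. -/
theorem comm_mul_self (i l : ℤ) : comm i l * comm i l = 1 := by
  have hinv : ∀ i : ℤ, (b i)⁻¹ = b i := fun i => inv_eq_of_mul_eq_one_right (b_mul_self i)
  rw [comm, ← map_mul]
  have h : b i * ⁅b i, b l⁆ * (b i)⁻¹ = ⁅b i, b l⁆⁻¹ := by
    rw [commutatorElement_inv, commutatorElement_def, commutatorElement_def]
    simp only [hinv, ← mul_assoc]
    rw [b_mul_self, one_mul]
  rw [← (commute_commutator (b i) (b l) (b i)).eq, mul_inv_cancel_right] at h
  rw [mul_eq_one_iff_eq_inv.2 h, map_one]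

theorem closure_b_eq_top : Subgroup.closure (Set.range b) = ⊤ := by
  rw [eq_top_iff]
  intro x _
  obtain ⟨x, rfl⟩ := QuotientGroup.mk_surjective x
  obtain ⟨w, rfl⟩ := QuotientGroup.mk_surjective x
  induction w using FreeGroup.induction_on with
  | C1 => exact Subgroup.one_mem _
  | of i => exact Subgroup.subset_closure ⟨i, rfl⟩
  | inv_of i h => exact Subgroup.inv_mem _ (h trivial)
  | mul v w hv hw => exact Subgroup.mul_mem _ (hv trivial) (hw trivial)

theorem closure_gens_id_eq_top : Subgroup.closure (gens (MonoidHom.id GNil2)) = ⊤ := by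
  set H := Subgroup.closure (gens (MonoidHom.id GNil2)) with hH
  have hz : (SemidirectProduct.inr (Multiplicative.ofAdd (1 : ℤ)) : GNil2) ∈ H :=
    Subgroup.subset_closure (Or.inr rfl)
  have hb : (SemidirectProduct.inl (b 0) : GNil2) ∈ H := Subgroup.subset_closure (Or.inl rfl)
  have hinr : ∀ m : Multiplicative ℤ, (SemidirectProduct.inr m : GNil2) ∈ H := by
    intro m
    have h : m = Multiplicative.ofAdd (1 : ℤ) ^ m.toAdd := by
      rw [← ofAdd_zsmul]
      simp
    rw [h, map_zpow]
    exact Subgroup.zpow_mem _ hz _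
  have hinl : (⊤ : Subgroup N2) ≤ H.comap SemidirectProduct.inl := by
    rw [← closure_b_eq_top, Subgroup.closure_le]
    rintro _ ⟨i, rfl⟩
    rw [SetLike.mem_coe, Subgroup.mem_comap, inl_b_eq]
    exact Subgroup.mul_mem _ (Subgroup.mul_mem _ (hinr _) hb) (hinr _)
  rw [eq_top_iff]
  intro g _
  rw [← SemidirectProduct.inl_left_mul_inr_right g]
  exact Subgroup.mul_mem _ (hinl (Subgroup.mem_top _)) (hinr _)

theorem closure_gens_eq_top {Q : Type*} [Group Q] {π : GNil2 →* Q}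
    (h : Function.Surjective π) : Subgroup.closure (gens π) = ⊤ := by
  have himg : gens π = π '' gens (MonoidHom.id GNil2) := by
    rw [gens, gens, Set.image_pair]
    rfl
  rw [himg, ← MonoidHom.map_closure, closure_gens_id_eq_top]
  exact Subgroup.map_top_of_surjective π h

theorem finite_gens {Q : Type*} [Group Q] (π : GNil2 →* Q) : (gens π).Finite :=
  (Set.finite_singleton _).insert _

/-! ### The lower bound -/

section LowerBound

variable {D : Set ℕ} {κ : ℕ → ℕ} {Q : Type*} [Group Q] {π : GNil2 →* Q}

/-- The word `z ^ i * b 0 * z ^ (-i)` has length `2 * i + 1`. -/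
theorem card_exits_b_le (π : GNil2 →* Q) (V : Finset Q) (i : ℕ) :
    (exits V (π (SemidirectProduct.inl (b i)))).card ≤
      (2 * i + 1) * (boundary (gens π) V).card := by
  rw [inl_b_natCast, map_mul, map_mul, map_inv, map_pow]
  have hz := (card_exits_pow V (π (SemidirectProduct.inr (Multiplicative.ofAdd 1))) i).trans
    (Nat.mul_le_mul_left i (card_exits_le_boundary (S := gens π) V (Or.inr rfl)))
  have hb : (exits V (π (SemidirectProduct.inl (b 0)))).card ≤ (boundary (gens π) V).card :=
    card_exits_le_boundary V (Or.inl rfl)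
  refine (card_exits_mul _ _ _).trans
    ((Nat.add_le_add_right (card_exits_mul _ _ _) _).trans ?_)
  rw [card_exits_inv]
  linarith

theorem card_exits_comm_le (π : GNil2 →* Q) (V : Finset Q) (i l : ℕ) :
    (exits V (π (comm i l))).card ≤ (4 * i + 4 * l + 4) * (boundary (gens π) V).card := by
  have hi := card_exits_b_le π V i
  have hl := card_exits_b_le π V l
  rw [comm, map_commutatorElement, map_commutatorElement, commutatorElement_def]
  refine (card_exits_mul _ _ _).trans ((Nat.add_le_add_right
    ((card_exits_mul _ _ _).trans (Nat.add_le_add_right (card_exits_mul _ _ _) _)) _).trans ?_)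
  rw [card_exits_inv, card_exits_inv]
  linarith

/-- A Følner set is exponentially large in the number of independent short elements. -/
theorem IsShiftQuotient.mul_log_two_le (h : IsShiftQuotient D κ π) {L n : ℕ} (hLn : 32 * L ≤ n)
    {V : Finset Q} (hV : IsFolnerSet (gens π) n V) :
    ((L : ℝ) + (pairs D κ L).card) * Real.log 2 ≤ 8 * Real.log V.card := by
  obtain ⟨Ψ, hΨ⟩ : ∃ Ψ : Q →* Equiv.Perm Config, ∀ g, Ψ (π g) = action D κ g :=
    ⟨MonoidHom.liftOfSurjective π h.surjective ⟨action D κ, h.ker_le_action⟩, fun g =>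
      MonoidHom.liftOfRightInverse_comp_apply _ _ _ _ g⟩
  -- The inverse turns right multiplication on `Q` into an action on configurations.
  set φ : Q → Config := fun v => (Ψ v)⁻¹ 0 with hφ
  have hφm : ∀ v g, φ (v * π g) = action D κ g⁻¹ (φ v) := by
    intro v g
    simp only [hφ, map_mul, hΨ, mul_inv_rev, Equiv.Perm.mul_apply, map_inv]
  have hzmod : ∀ x : ZMod 2, x + 1 = 0 ↔ ¬ x = 0 := by decide
  -- With indices `r < L` and `r + j < 2 * L`, all words used have length at most `16 * L`, and `2 *
  -- 16 * L ≤ n`.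
  have hsmall : ∀ (g : Q) (c : ℕ), c ≤ 16 * L →
      (exits V g).card ≤ c * (boundary (gens π) V).card → 2 * (exits V g).card ≤ V.card := by
    intro g c hc hg
    calc 2 * (exits V g).card ≤ 2 * (c * (boundary (gens π) V).card) := Nat.mul_le_mul_left 2 hg
      _ = (2 * c) * (boundary (gens π) V).card := by ring
      _ ≤ n * (boundary (gens π) V).card := Nat.mul_le_mul_right _ (by omega)
      _ ≤ V.card := hV.2
  have h1 : ((Finset.range L).card : ℝ) * Real.log 2 ≤ 4 * Real.log V.card := by
    have hb : ∀ (i : ℕ) (v : Q) (r : ℤ),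
        (φ (v * π (SemidirectProduct.inl (b i)))).1 r = (φ v).1 r + if r = i then 1 else 0 := by
      intro i v r
      rw [hφm, map_inv, action_b, toggle_inv, toggle_apply]
      dsimp only
      rw [Pi.add_apply, Pi.single_apply]
    refine card_mul_log_two_le_four_mul_log_card
      (fun i : ℕ => π (SemidirectProduct.inl (b i)))
      (fun i v => (φ v).1 i = 0) _ ?_ ?_ hV.1 ?_
    · intro i _ v
      simp only [hb, if_true, hzmod]
    · intro i _ j _ hij v
      simp only [hb]
      rw [if_neg (by exact_mod_cast hij.symm), add_zero]
    · intro i hi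
      rw [Finset.mem_range] at hi
      exact hsmall _ (2 * i + 1) (by omega) (card_exits_b_le π V i)
  -- The commutators are treated separately because the `b i` may also change commutator
  -- coordinates. Adding the two estimates gives the constant `8`.
  have h2 : ((pairs D κ L).card : ℝ) * Real.log 2 ≤ 4 * Real.log V.card := by
    classical
    have hc : ∀ (p : ℕ × ℕ) (v : Q) (j : ℕ) (r : ℤ), 1 ≤ p.1 →
        (φ (v * π (comm p.2 (p.2 + p.1 : ℕ)))).2 j r =
          (φ v).2 j r + if j = p.1 ∧ p.1 ∉ D ∧ (κ p.1 : ℤ) ∣ r - p.2 then 1 else 0 := by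
      intro p v j r hp
      rw [hφm, ← comm_swap, action_comm, add_assoc, add_comm (pairing D κ _ _), Nat.cast_add]
      dsimp only
      rw [Pi.add_apply, Pi.add_apply, pairing_add_pairing_apply D κ hp]
    refine card_mul_log_two_le_four_mul_log_card
      (fun p : ℕ × ℕ => π (comm p.2 (p.2 + p.1 : ℕ)))
      (fun p v => (φ v).2 p.1 p.2 = 0) _ ?_ ?_ hV.1 ?_
    · intro p hp v
      obtain ⟨⟨hp1, -⟩, -, hpD, -⟩ := mem_pairs.1 hp
      simp only [hc p v _ _ hp1]
      rw [if_pos ⟨trivial, hpD, by simp⟩, hzmod]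
    · intro p hp q hq hpq v
      obtain ⟨⟨hp1, -⟩, -, hpD, hpκ⟩ := mem_pairs.1 hp
      obtain ⟨-, -, -, hqκ⟩ := mem_pairs.1 hq
      simp only [hc p v _ _ hp1]
      rw [if_neg, add_zero]
      rintro ⟨he, -, hd⟩
      refine hpq (Prod.ext he.symm ?_)
      rw [he] at hqκ
      -- Divisibility by `0` is equality. Otherwise both positions lie in `[0, κ j)`, so being
      -- congruent they coincide.
      rcases hpκ with h0 | hpκ
      · rw [h0, Nat.cast_zero, zero_dvd_iff] at hd
        omega
      · have hqκ : q.2 < κ p.1 := hqκ.resolve_left (by omega)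
        have := Int.eq_zero_of_abs_lt_dvd hd (by rw [abs_lt]; omega)
        omega
    · intro p hp
      obtain ⟨⟨hp1, hpL⟩, hp2, -⟩ := mem_pairs.1 hp
      exact hsmall _ _ (by omega) (card_exits_comm_le π V p.2 (p.2 + p.1))
  rw [Finset.card_range] at h1
  linarith

/-- In a non-trivial group a singleton is not a Følner set. -/
theorem IsShiftQuotient.two_le_card (h : IsShiftQuotient D κ π) {n : ℕ} (hn : 2 ≤ n)
    {V : Finset Q} (hV : IsFolnerSet (gens π) n V) : 2 ≤ V.card := by
  by_contra hlt
  have h1 : V.card = 1 := by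
    have := hV.1.card_pos
    omega
  have h0 : (boundary (gens π) V).card = 0 := by
    have := hV.2
    by_contra hne
    have : n * 1 ≤ n * (boundary (gens π) V).card :=
      Nat.mul_le_mul_left n (Nat.one_le_iff_ne_zero.2 hne)
    omega
  obtain ⟨v, rfl⟩ := Finset.card_eq_one.1 h1
  -- An empty boundary would give `v * π z = v`, hence `π z = 1`, although `z` is non-trivial in the
  -- quotient `ℤ`.
  have hex := card_exits_le_boundary {v} (S := gens π)
    (s := π (SemidirectProduct.inr (Multiplicative.ofAdd 1))) (Or.inr rfl)
  rw [h0, Nat.le_zero, Finset.card_eq_zero, Finset.eq_empty_iff_forall_notMem] at hex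
  have hv := hex v
  rw [mem_exits, Finset.mem_singleton, Finset.mem_singleton, mul_eq_left] at hv
  refine hv ⟨rfl, fun he => ?_⟩
  have := h.ker_le_rightHom (MonoidHom.mem_ker.2 he)
  rw [MonoidHom.mem_ker, SemidirectProduct.rightHom_inr] at this
  exact absurd this (by decide)

end LowerBound

/-! ### The upper bound -/

/-- An involution `g` normalizing `K = ⟨S⟩` makes `K ∪ K * g` a group, so adjoining it at most
doubles the order. -/
theorem exists_finset_closure_insert {Q : Type*} [Group Q] {S : Set Q} {g : Q} {F : Finset Q}
    (hF : ∀ x ∈ Subgroup.closure S, x ∈ F) (hg : g * g = 1)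
    (hn : ∀ s ∈ S, g * s * g⁻¹ ∈ Subgroup.closure S) :
    ∃ F' : Finset Q, (∀ x ∈ Subgroup.closure (insert g S), x ∈ F') ∧ F'.card ≤ 2 * F.card := by
  classical
  set K := Subgroup.closure S with hK
  have hg' : g⁻¹ = g := inv_eq_of_mul_eq_one_right hg
  have hconj : ∀ x ∈ K, g * x * g ∈ K := by
    have : K ≤ K.comap (MulAut.conj g).toMonoidHom := by
      rw [hK, Subgroup.closure_le]
      exact fun s hs => hn s hs
    intro x hx
    have h := this hx
    rw [Subgroup.mem_comap] at h
    change g * x * g⁻¹ ∈ K at h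
    rwa [hg'] at h
  have hcases : ∀ x ∈ Subgroup.closure (insert g S), x ∈ K ∨ x * g ∈ K := by
    intro x hx
    induction hx using Subgroup.closure_induction with
    | mem s hs =>
      rcases hs with rfl | hs
      · right
        rw [hg]
        exact K.one_mem
      · exact Or.inl (Subgroup.subset_closure hs)
    | one => exact Or.inl K.one_mem
    | mul x y _ _ hx hy =>
      rcases hx with hx | hx <;> rcases hy with hy | hy
      · exact Or.inl (K.mul_mem hx hy)
      · right
        rw [mul_assoc]
        exact K.mul_mem hx hy
      · right
        have := K.mul_mem hx (hconj y hy)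
        rwa [show x * g * (g * y * g) = x * (g * g) * y * g by group, hg, mul_one] at this
      · left
        have := K.mul_mem hx (hconj _ hy)
        rwa [show x * g * (g * (y * g) * g) = x * (g * g) * y * (g * g) by group, hg, mul_one,
          mul_one] at this
    | inv x _ hx =>
      rcases hx with hx | hx
      · exact Or.inl (K.inv_mem hx)
      · right
        have := hconj _ (K.inv_mem hx)
        rwa [mul_inv_rev, hg', ← mul_assoc, hg, one_mul] at this
  refine ⟨F ∪ F.image (fun x => x * g), fun x hx => ?_, ?_⟩
  · rw [Finset.mem_union, Finset.mem_image]
    rcases hcases x hx with h | h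
    · exact Or.inl (hF x h)
    · exact Or.inr ⟨x * g, hF _ h, by rw [mul_assoc, hg, mul_one]⟩
  · refine (Finset.card_union_le _ _).trans ?_
    have := Finset.card_image_le (s := F) (f := fun x => x * g)
    omega

theorem exists_finset_closure_image {Q ι : Type*} [Group Q] (c : ι → Q) (I : Finset ι)
    (hsq : ∀ i ∈ I, c i * c i = 1) (hcomm : ∀ i ∈ I, ∀ j ∈ I, Commute (c i) (c j)) :
    ∃ F : Finset Q, (∀ x ∈ Subgroup.closure (c '' I), x ∈ F) ∧ F.card ≤ 2 ^ I.card := by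
  classical
  induction I using Finset.induction_on with
  | empty =>
    refine ⟨{1}, fun x hx => ?_, by simp⟩
    simpa using hx
  | insert i I hi ih =>
    obtain ⟨F, hF, hcard⟩ := ih (fun j hj => hsq j (Finset.mem_insert_of_mem hj))
      (fun j hj l hl => hcomm j (Finset.mem_insert_of_mem hj) l (Finset.mem_insert_of_mem hl))
    obtain ⟨F', hF', hcard'⟩ := exists_finset_closure_insert hF
      (hsq i (Finset.mem_insert_self i I)) (by
        rintro _ ⟨j, hj, rfl⟩
        have := hcomm i (Finset.mem_insert_self i I) j (Finset.mem_insert_of_mem hj)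
        rw [this.eq, mul_inv_cancel_right]
        exact Subgroup.subset_closure ⟨j, hj, rfl⟩)
    refine ⟨F', ?_, ?_⟩
    · rwa [Finset.coe_insert, Set.image_insert_eq]
    · rw [Finset.card_insert_of_notMem hi, pow_succ]
      omega

section UpperBound

variable {D : Set ℕ} {κ : ℕ → ℕ} {Q : Type*} [Group Q] {π : GNil2 →* Q}

/-- The generators of the commutators of `b 0, …, b (L - 1)`. -/
def commSet (D : Set ℕ) (κ : ℕ → ℕ) (π : GNil2 →* Q) (L : ℕ) : Set Q :=
  (fun p : ℕ × ℕ => π (comm p.2 (p.2 + p.1 : ℕ))) '' (pairs D κ L)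

/-- The generators of the subgroup generated by `b 0, …, b (m - 1)` and the commutators of
`b 0, …, b (L - 1)`. -/
def blockSet (D : Set ℕ) (κ : ℕ → ℕ) (π : GNil2 →* Q) (L m : ℕ) : Set Q :=
  commSet D κ π L ∪ (fun i : ℕ => π (SemidirectProduct.inl (b i))) '' Set.Iio m

/-- Periodicity lowers `i` by `κ j` until it lies in the range recorded by `pairs`. -/
theorem IsShiftQuotient.comm_mem_closure (h : IsShiftQuotient D κ π) {L i j : ℕ} (hi : i < L)
    (hj : 1 ≤ j) (hjL : j ≤ L) :
    π (comm i (i + j : ℕ)) ∈ Subgroup.closure (commSet D κ π L) := by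
  by_cases hD : j ∈ D
  · rw [Nat.cast_add, h.comm_eq_one i j hj hD]
    exact Subgroup.one_mem _
  induction i using Nat.strong_induction_on with
  | _ i ih =>
    by_cases hκ : κ j = 0 ∨ i < κ j
    · exact Subgroup.subset_closure ⟨(j, i), mem_pairs.2 ⟨⟨hj, hjL⟩, hi, hD, hκ⟩, rfl⟩
    · rw [not_or, not_lt] at hκ
      have h1 := ih (i - κ j) (by omega) (by omega)
      have h2 := h.comm_period ((i - κ j : ℕ) : ℤ) j hj
      have h3 : (((i - κ j : ℕ) : ℤ) + κ j) = i := by omega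
      rw [add_right_comm, h3] at h2
      rw [Nat.cast_add] at h1 ⊢
      rwa [h2]

/-- Start from the commuting involutions `[b r, b (r + j)]`, then adjoin the `b m` in turn.
Conjugation by `b m` changes `b i` only by a commutator already present, so each step at most
doubles the order. -/
theorem IsShiftQuotient.exists_finset_blockSet (h : IsShiftQuotient D κ π) {L m : ℕ}
    (hm : m ≤ L) :
    ∃ F : Finset Q, (∀ x ∈ Subgroup.closure (blockSet D κ π L m), x ∈ F) ∧
      F.card ≤ 2 ^ ((pairs D κ L).card + m) := by
  induction m with
  | zero =>
    obtain ⟨F, hF, hcard⟩ := exists_finset_closure_image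
      (fun p : ℕ × ℕ => π (comm p.2 (p.2 + p.1 : ℕ))) (pairs D κ L)
      (fun p _ => by rw [← map_mul, comm_mul_self, map_one])
      (fun p _ q _ => (commute_comm_inl _ _ _).map π)
    refine ⟨F, fun x hx => hF x ?_, hcard⟩
    have h0 : blockSet D κ π L 0 = commSet D κ π L := by simp [blockSet]
    rwa [h0] at hx
  | succ m ih =>
    obtain ⟨F, hF, hcard⟩ := ih (by omega)
    obtain ⟨F', hF', hcard'⟩ := exists_finset_closure_insert (g := π (SemidirectProduct.inl (b m)))
      hF (by rw [← map_mul, ← map_mul, b_mul_self, map_one, map_one]) (by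
        rintro _ (⟨p, hp, rfl⟩ | ⟨i, hi, rfl⟩)
        · have := (commute_comm_inl p.2 (p.2 + p.1 : ℕ) (b m)).map π
          dsimp only
          rw [← this.eq, mul_inv_cancel_right]
          exact Subgroup.subset_closure (Or.inl ⟨p, hp, rfl⟩)
        · have hi : i < m := hi
          have hc := h.comm_mem_closure (L := L) (i := i) (j := m - i) (by omega) (by omega)
            (by omega)
          rw [Nat.add_sub_cancel' hi.le] at hc
          have he : ∀ x y : Q, x * y * x⁻¹ = ⁅y, x⁆⁻¹ * y := fun x y => by
            rw [commutatorElement_def]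
            group
          dsimp only
          rw [he, ← map_commutatorElement, ← map_commutatorElement]
          refine Subgroup.mul_mem _ (Subgroup.inv_mem _ ?_)
            (Subgroup.subset_closure (Or.inr ⟨i, hi, rfl⟩))
          exact Subgroup.closure_mono Set.subset_union_left hc)
    refine ⟨F', fun x hx => hF' x ?_, ?_⟩
    · have hins : blockSet D κ π L (m + 1) =
          insert (π (SemidirectProduct.inl (b m))) (blockSet D κ π L m) := by
        have hIio : Set.Iio (m + 1) = insert m (Set.Iio m) := by
          ext i
          simp only [Set.mem_Iio, Set.mem_insert_iff]
          omega
        rw [blockSet, blockSet, hIio, Set.image_insert_eq, Set.union_insert]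
      rwa [hins] at hx
    · rw [← add_assoc, pow_succ]
      omega

theorem IsShiftQuotient.exists_isFolnerSet (h : IsShiftQuotient D κ π) {n : ℕ} (hn : 1 ≤ n) :
    ∃ V : Finset Q, IsFolnerSet (gens π) n V ∧
      V.card ≤ 2 ^ ((pairs D κ (2 * n)).card + 2 * n) * (2 * n) := by
  classical
  set L := 2 * n with hL
  obtain ⟨F, hF, hcard⟩ := h.exists_finset_blockSet (L := L) le_rfl
  set A := Subgroup.closure (blockSet D κ π L L) with hA
  -- `F` is only known to contain `A`; filtering recovers `A` exactly.
  set A' := F.filter (· ∈ A) with hA'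
  have hmem : ∀ x, x ∈ A' ↔ x ∈ A := fun x => by
    rw [hA', Finset.mem_filter]
    exact ⟨fun hx => hx.2, fun hx => ⟨hF x hx, hx⟩⟩
  set z : Q := π (SemidirectProduct.inr (Multiplicative.ofAdd 1)) with hz
  set β : Q := π (SemidirectProduct.inl (b 0)) with hβ
  have hAinl : A ≤ (SemidirectProduct.inl : N2 →* GNil2).range.map π := by
    rw [hA, Subgroup.closure_le]
    rintro _ (⟨p, _, rfl⟩ | ⟨i, _, rfl⟩)
    · exact ⟨_, ⟨_, rfl⟩, rfl⟩
    · exact ⟨_, ⟨_, rfl⟩, rfl⟩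
  -- `A` comes from `N2`, so the projection to `ℤ` reads off the layer.
  have hdeg : ∀ a ∈ A, ∀ a' ∈ A, ∀ m m' : ℕ, a * z ^ m = a' * z ^ m' → m = m' := by
    intro a ha a' ha' m m' he
    obtain ⟨_, ⟨x, rfl⟩, rfl⟩ := hAinl ha
    obtain ⟨_, ⟨x', rfl⟩, rfl⟩ := hAinl ha'
    rw [hz, ← map_pow π, ← map_pow π, ← map_mul π, ← map_mul π, ← mul_inv_eq_one, ← map_inv π,
      ← map_mul π] at he
    have hk := h.ker_le_rightHom (MonoidHom.mem_ker.2 he)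
    rw [MonoidHom.mem_ker, map_mul, map_inv, map_mul, map_mul, SemidirectProduct.rightHom_inl,
      SemidirectProduct.rightHom_inl, one_mul, one_mul, mul_inv_eq_one, map_pow, map_pow,
      SemidirectProduct.rightHom_inr, ← ofAdd_nsmul, ← ofAdd_nsmul] at hk
    have := Multiplicative.ofAdd.injective hk
    simpa using this
  set f : Q × ℕ → Q := fun p => p.1 * z ^ p.2 with hf
  have hinj : Set.InjOn f (A' ×ˢ Finset.range L : Finset (Q × ℕ)) := by
    rintro ⟨a, m⟩ hp ⟨a', m'⟩ hp' he
    rw [Finset.mem_coe, Finset.mem_product, hmem] at hp hp'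
    have hm := hdeg a hp.1 a' hp'.1 m m' he
    subst hm
    exact Prod.ext (mul_right_cancel he) rfl
  set V := (A' ×ˢ Finset.range L).image f with hV
  have hVcard : V.card = A'.card * L := by
    rw [hV, Finset.card_image_of_injOn hinj, Finset.card_product, Finset.card_range]
  have hVmem : ∀ a ∈ A, ∀ m < L, a * z ^ m ∈ V := fun a ha m hm =>
    Finset.mem_image.2 ⟨(a, m), Finset.mem_product.2 ⟨(hmem a).2 ha, Finset.mem_range.2 hm⟩, rfl⟩
  have hbA : ∀ m < L, z ^ m * β * (z ^ m)⁻¹ ∈ A := by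
    intro m hm
    refine Subgroup.subset_closure (Or.inr ⟨m, hm, ?_⟩)
    dsimp only
    rw [inl_b_natCast, map_mul, map_mul, map_inv, map_pow]
  have hββ : β⁻¹ = β := by
    refine inv_eq_of_mul_eq_one_right ?_
    rw [hβ, ← map_mul, ← map_mul, b_mul_self, map_one, map_one]
  -- Right multiplication by `b 0` preserves each layer, since `z ^ m * b 0 * z ^ (-m) = b m` lies
  -- in `A`; `z` and its inverse change the layer by one.
  have hbd : boundary (gens π) V ⊆ (A' ×ˢ {0, L - 1}).image f := by
    intro v hv
    obtain ⟨hvV, s, hs, hvs⟩ := mem_boundary.1 hv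
    obtain ⟨⟨a, m⟩, hp, rfl⟩ := Finset.mem_image.1 hvV
    rw [Finset.mem_product, Finset.mem_range, hmem] at hp
    refine Finset.mem_image.2 ⟨(a, m), Finset.mem_product.2 ⟨(hmem a).2 hp.1, ?_⟩, rfl⟩
    by_contra hm
    simp only [Finset.mem_insert, Finset.mem_singleton, not_or] at hm
    have hmβ : a * z ^ m * β ∈ V := by
      rw [show a * z ^ m * β = a * (z ^ m * β * (z ^ m)⁻¹) * z ^ m by group]
      exact hVmem _ (A.mul_mem hp.1 (hbA m hp.2)) m hp.2
    have hmz : a * z ^ m * z ∈ V := by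
      rw [mul_assoc, ← pow_succ]
      exact hVmem a hp.1 (m + 1) (by have := hp.2; omega)
    have hmz' : a * z ^ m * z⁻¹ ∈ V := by
      obtain ⟨l, rfl⟩ := Nat.exists_eq_succ_of_ne_zero hm.1
      rw [pow_succ, ← mul_assoc, mul_inv_cancel_right]
      exact hVmem a hp.1 l (by have := hp.2; omega)
    rcases hs with rfl | hs
    · change a * z ^ m * β ∉ V ∨ a * z ^ m * β⁻¹ ∉ V at hvs
      rw [hββ] at hvs
      tauto
    · rw [Set.mem_singleton_iff.1 hs] at hvs
      change a * z ^ m * z ∉ V ∨ a * z ^ m * z⁻¹ ∉ V at hvs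
      tauto
  refine ⟨V, ⟨⟨1 * z ^ 0, hVmem 1 A.one_mem 0 (by omega)⟩, ?_⟩, ?_⟩
  · have h1 : (boundary (gens π) V).card ≤ A'.card * 2 := by
      refine (Finset.card_le_card hbd).trans (Finset.card_image_le.trans ?_)
      rw [Finset.card_product]
      exact Nat.mul_le_mul_left _ Finset.card_le_two
    calc n * (boundary (gens π) V).card ≤ n * (A'.card * 2) := Nat.mul_le_mul_left n h1
      _ = V.card := by rw [hVcard, hL]; ring
  · rw [hVcard]
    exact Nat.mul_le_mul_right _ ((Finset.card_filter_le _ _).trans hcard)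

end UpperBound

/-! ### The two families of groups -/

theorem comm_mem_BD {D : Set ℕ} (i : ℤ) {j : ℕ} (hj : j ∈ D) : comm i (i + j) ∈ BD D := by
  rw [comm_swap]
  exact Subgroup.inv_mem _ (Subgroup.subset_normalClosure ⟨i + j, i, j, hj, by ring, rfl⟩)

theorem isShiftQuotient_GD (D : Set ℕ) :
    IsShiftQuotient D (fun _ => 0) (QuotientGroup.mk' (BD D)) where
  surjective := QuotientGroup.mk'_surjective _
  comm_eq_one i j _ hD := (QuotientGroup.eq_one_iff _).2 (comm_mem_BD i hD)
  comm_period i j _ := by simp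
  ker_le_action := by
    rw [QuotientGroup.ker_mk']
    exact BD_le_ker_action D _
  ker_le_rightHom := by
    rw [QuotientGroup.ker_mk']
    exact BD_le_ker_rightHom D

/-- An element killed by the two successive quotients is a product of an element of `periodic k` and
one of `BD D`. -/
theorem ker_projDk_le {D : Set ℕ} {k : ℕ → ℕ+} {H : Subgroup GNil2} (h1 : BD D ≤ H)
    (h2 : periodic k ≤ H) : (projDk D k).ker ≤ H := by
  intro g hg
  have hg' : (QuotientGroup.mk' (BD D) g) ∈ periodicImage D k :=
    (QuotientGroup.eq_one_iff _).1 hg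
  obtain ⟨p, hp, he⟩ := hg'
  have hpg : p⁻¹ * g ∈ BD D := QuotientGroup.eq.1 he
  have := H.mul_mem (h2 hp) (h1 hpg)
  rwa [mul_inv_cancel_left] at this

theorem isShiftQuotient_GDk (D : Set ℕ) (k : ℕ → ℕ+) :
    IsShiftQuotient D (fun j => (k j : ℕ)) (projDk D k) where
  surjective := (QuotientGroup.mk'_surjective _).comp (QuotientGroup.mk'_surjective _)
  comm_eq_one i j _ hD := by
    have h : QuotientGroup.mk' (BD D) (comm i (i + j)) = 1 :=
      (QuotientGroup.eq_one_iff _).2 (comm_mem_BD i hD)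
    rw [projDk, MonoidHom.comp_apply, h, map_one]
  comm_period i j hj := by
    rw [eq_comm, ← mul_inv_eq_one, ← map_inv, ← map_mul]
    refine (QuotientGroup.eq_one_iff _).2 ⟨_, Subgroup.subset_normalClosure ⟨i, j, hj, rfl⟩, rfl⟩
  ker_le_action := ker_projDk_le (BD_le_ker_action D _) (periodic_le_ker_action D k)
  ker_le_rightHom := ker_projDk_le (BD_le_ker_rightHom D) (periodic_le_ker_rightHom k)

/-! ### Counting pairs -/

open Classical in
theorem card_pairs_eq_sum (D : Set ℕ) (κ : ℕ → ℕ) (L : ℕ) :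
    (pairs D κ L).card = ∑ j ∈ (Finset.Icc 1 L).filter (· ∉ D),
      ((Finset.range L).filter fun r => κ j = 0 ∨ r < κ j).card := by
  rw [pairs, Finset.card_filter, Finset.sum_product, Finset.sum_filter]
  refine Finset.sum_congr rfl fun j _ => ?_
  split_ifs with hj
  · exact Finset.sum_eq_zero fun r _ => if_neg fun h => h.1 hj
  · rw [Finset.card_filter]
    exact Finset.sum_congr rfl fun r _ => if_congr (and_iff_right hj) rfl rfl

theorem card_pairs_zero (D : Set ℕ) (L : ℕ) : (pairs D (fun _ => 0) L).card = L * rho D L := by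
  classical
  rw [card_pairs_eq_sum, rho]
  simp [mul_comm]

theorem card_pairs_eq_tau (D : Set ℕ) (k : ℕ → ℕ+) (L : ℕ) :
    ((pairs D (fun j => (k j : ℕ)) L).card : ℝ) = tau D k L := by
  classical
  rw [card_pairs_eq_sum, tau, Nat.floor_natCast, Nat.cast_sum]
  refine Finset.sum_congr rfl fun j _ => ?_
  rw [← Nat.cast_min, Nat.cast_inj]
  have h : ((Finset.range L).filter fun r => (k j : ℕ) = 0 ∨ r < (k j : ℕ)) =
      Finset.range (min (k j) L) := by
    ext r
    simp only [Finset.mem_filter, Finset.mem_range, PNat.ne_zero, false_or, lt_min_iff]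
    exact and_comm
  rw [h, Finset.card_range]

theorem tau_mono (D : Set ℕ) (k : ℕ → ℕ+) {x y : ℝ} (h : x ≤ y) : tau D k x ≤ tau D k y := by
  classical
  refine (Finset.sum_le_sum fun j _ => min_le_min_left _ h).trans ?_
  refine Finset.sum_le_sum_of_subset_of_nonneg ?_ ?_
  · exact Finset.filter_subset_filter _ (Finset.Icc_subset_Icc_right (Nat.floor_mono h))
  · intro j hj _
    rw [Finset.mem_filter, Finset.mem_Icc] at hj
    -- An index in the larger range forces `y ≥ 1`, so the extra terms are non-negative even though
    -- `y` is an arbitrary real.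
    have hy := (Nat.one_le_floor_iff _).1 (hj.1.1.trans hj.1.2)
    exact le_min (Nat.cast_nonneg _) (by linarith)

theorem rho_mono (D : Set ℕ) {m n : ℕ} (h : m ≤ n) : rho D m ≤ rho D n := by
  classical
  exact Finset.card_le_card (Finset.filter_subset_filter _ (Finset.Icc_subset_Icc_right h))

/-! ### Bounds for Følner functions -/

section Bounds

variable {D : Set ℕ} {κ : ℕ → ℕ} {Q : Type*} [Group Q] {π : GNil2 →* Q}

theorem IsShiftQuotient.Fol_le (h : IsShiftQuotient D κ π) {n : ℕ} (hn : 1 ≤ n) :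
    (Fol (gens π) n : ℝ) ≤ Real.exp (4 * n + 2 * (pairs D κ (2 * n)).card) := by
  obtain ⟨V, hV, hcard⟩ := h.exists_isFolnerSet hn
  -- The number `2 * n` of layers is absorbed into `2 ^ (2 * n)`.
  have h1 : Fol (gens π) n ≤ 2 ^ (4 * n + 2 * (pairs D κ (2 * n)).card) := by
    refine (Fol_le_card hn hV).trans (hcard.trans ?_)
    calc 2 ^ ((pairs D κ (2 * n)).card + 2 * n) * (2 * n)
        ≤ 2 ^ ((pairs D κ (2 * n)).card + 2 * n) * 2 ^ (2 * n) :=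
          Nat.mul_le_mul_left _ Nat.lt_two_pow_self.le
      _ = 2 ^ ((pairs D κ (2 * n)).card + 2 * n + 2 * n) := (pow_add _ _ _).symm
      _ ≤ _ := Nat.pow_le_pow_right two_pos (by omega)
  calc (Fol (gens π) n : ℝ) ≤ (2 : ℝ) ^ (4 * n + 2 * (pairs D κ (2 * n)).card) := by
        exact_mod_cast h1
    _ ≤ Real.exp 1 ^ (4 * n + 2 * (pairs D κ (2 * n)).card) := by
        have := Real.add_one_le_exp 1
        gcongr
        linarith
    _ = _ := by
        rw [← Real.exp_nat_mul, mul_one]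
        push_cast
        rfl

theorem IsShiftQuotient.le_log_Fol (h : IsShiftQuotient D κ π) {L n : ℕ} (hn : 1 ≤ n)
    (hLn : 32 * L ≤ n) :
    ((L : ℝ) + (pairs D κ L).card) * Real.log 2 ≤ 8 * Real.log (Fol (gens π) n) := by
  obtain ⟨V, hV, -⟩ := h.exists_isFolnerSet hn
  obtain ⟨W, hW, hcard⟩ := exists_isFolnerSet_card_eq_Fol hn ⟨V, hV⟩
  rw [← hcard]
  exact h.mul_log_two_le hLn hW

theorem IsShiftQuotient.two_le_Fol (h : IsShiftQuotient D κ π) {n : ℕ} (hn : 2 ≤ n) :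
    2 ≤ Fol (gens π) n := by
  obtain ⟨V, hV, -⟩ := h.exists_isFolnerSet (one_le_two.trans hn)
  obtain ⟨W, hW, hcard⟩ := exists_isFolnerSet_card_eq_Fol (one_le_two.trans hn) ⟨V, hV⟩
  rw [← hcard]
  exact h.two_le_card hn hW

/-- The Følner function with respect to an arbitrary finite generating set. -/
theorem IsShiftQuotient.exists_log_Fol_bounds (h : IsShiftQuotient D κ π) {S : Set Q}
    (hS : S.Finite) (hS' : Subgroup.closure S = ⊤) :
    (∀ n, 1 ≤ n → 1 ≤ Fol S n) ∧
    (∃ K : ℕ, 0 < K ∧ ∀ n : ℕ, 1 ≤ n →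
      Real.log (Fol S n) ≤ 2 * ((2 * K * n : ℕ) : ℝ) + 2 * (pairs D κ (2 * K * n)).card) ∧
    (∃ K : ℕ, 0 < K ∧ ∀ n : ℕ, 1 ≤ n →
      (n : ℝ) + (pairs D κ n).card ≤ 12 * Real.log (Fol S (K * n))) := by
  have hgen := closure_gens_eq_top h.surjective
  obtain ⟨K, hK, hSK⟩ := exists_Fol_le_Fol hS hgen
    (fun n hn => (h.exists_isFolnerSet hn).imp fun _ hV => hV.1)
  obtain ⟨K', hK', hSK'⟩ := exists_Fol_le_Fol (finite_gens π) hS' (fun n hn => (hSK n hn).2)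
  have hpos : ∀ n, 1 ≤ n → 1 ≤ Fol S n := by
    intro n hn
    obtain ⟨W, hW, hcard⟩ := exists_isFolnerSet_card_eq_Fol hn (hSK n hn).2
    rw [← hcard]
    exact hW.1.card_pos
  refine ⟨hpos, ⟨K, hK, fun n hn => ?_⟩, ⟨K' * 32, by omega, fun n hn => ?_⟩⟩
  · have hKn : 1 ≤ K * n := Nat.mul_pos hK hn
    rw [Real.log_le_iff_le_exp (by exact_mod_cast hpos n hn)]
    calc (Fol S n : ℝ) ≤ Fol (gens π) (K * n) := by exact_mod_cast (hSK n hn).1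
      _ ≤ _ := h.Fol_le hKn
      _ = _ := by
        rw [← mul_assoc]
        push_cast
        congr 1
        ring
  · have hn32 : 1 ≤ 32 * n := by omega
    have h1 := h.le_log_Fol hn32 (le_refl (32 * n))
    have h2 : Fol (gens π) (32 * n) ≤ Fol S (K' * 32 * n) := by
      rw [mul_assoc]
      exact (hSK' _ hn32).1
    have h3 := h.two_le_Fol (n := 32 * n) (by omega)
    have h4 : Real.log (Fol (gens π) (32 * n)) ≤ Real.log (Fol S (K' * 32 * n)) :=
      Real.log_le_log (by exact_mod_cast two_pos.trans_le h3) (by exact_mod_cast h2)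
    have h5 : (0 : ℝ) ≤ (n : ℝ) + (pairs D κ n).card := by positivity
    -- The constant `12` comes from `8 / log 2 < 12`.
    have h6 := mul_le_mul_of_nonneg_left Real.log_two_gt_d9.le h5
    linarith

end Bounds

/-! ### Asymptotic comparison -/

theorem AsympLE.trans {f g h : ℕ → ℝ} (hfg : AsympLE f g) (hgh : AsympLE g h) : AsympLE f h := by
  obtain ⟨C, K, hC, hK, h1⟩ := hfg
  obtain ⟨C', K', hC', hK', h2⟩ := hgh
  refine ⟨C * C', K' * K, mul_pos hC hC', Nat.mul_pos hK' hK, fun n hn => ?_⟩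
  rw [mul_assoc, mul_assoc]
  exact (h1 n hn).trans (mul_le_mul_of_nonneg_left (h2 _ (Nat.mul_pos hK hn)) hC.le)

theorem AsympEquiv.trans {f g h : ℕ → ℝ} (hfg : AsympEquiv f g) (hgh : AsympEquiv g h) :
    AsympEquiv f h :=
  ⟨hfg.1.trans hgh.1, hgh.2.trans hfg.2⟩

theorem le_of_forall_le_succ {f : ℕ → ℝ} (hf : ∀ n, 1 ≤ n → f n ≤ f (n + 1)) {m n : ℕ}
    (hm : 1 ≤ m) (hmn : m ≤ n) : f m ≤ f n := by
  induction n, hmn using Nat.le_induction with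
  | base => exact le_rfl
  | succ n hmn ih => exact ih.trans (hf n (hm.trans hmn))

/-- The additive error becomes `c * n` in the exponent, which the summand `n` absorbs after
rescaling by `c + 1`. -/
theorem asympLE_exp_of_le_add {f g : ℕ → ℝ} {c : ℕ} (hg : ∀ n, 1 ≤ n → 0 ≤ g n)
    (hg' : ∀ n, 1 ≤ n → g n ≤ g (n + 1)) (hfg : ∀ n, 1 ≤ n → f n ≤ g n + c) :
    AsympLE (fun n => Real.exp ((n : ℝ) * f n + (n : ℝ)))
      (fun n => Real.exp ((n : ℝ) * g n + (n : ℝ))) := by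
  refine ⟨1, c + 1, one_pos, Nat.succ_pos c, fun n hn => ?_⟩
  rw [one_mul, Real.exp_le_exp]
  have hle : n ≤ (c + 1) * n := Nat.le_mul_of_pos_left n (Nat.succ_pos c)
  have h1 := le_of_forall_le_succ hg' hn hle
  have h2 : (n : ℝ) * f n ≤ n * (g n + c) := mul_le_mul_of_nonneg_left (hfg n hn) (by positivity)
  have h3 : (n : ℝ) * g n ≤ (((c + 1) * n : ℕ) : ℝ) * g ((c + 1) * n) :=
    mul_le_mul (by exact_mod_cast hle) h1 (hg n hn) (by positivity)
  push_cast at h3 ⊢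
  linarith

theorem asympEquiv_Fol_GD (D : Set ℕ) {S : Set (GD D)} (hS : S.Finite)
    (hS' : Subgroup.closure S = ⊤) :
    AsympEquiv (fun n => (Fol S n : ℝ))
      (fun n => Real.exp ((n : ℝ) * (rho D n : ℝ) + (n : ℝ))) := by
  obtain ⟨hpos, ⟨K, hK, hup⟩, ⟨K', hK', hlow⟩⟩ :=
    (isShiftQuotient_GD D).exists_log_Fol_bounds hS hS'
  simp only [card_pairs_zero] at hup hlow
  constructor
  · refine ⟨1, 2 * (2 * K), one_pos, by omega, fun n hn => ?_⟩
    dsimp only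
    rw [one_mul, ← Real.log_le_iff_le_exp (by exact_mod_cast hpos n hn)]
    refine (hup n hn).trans ?_
    have h1 : rho D (2 * K * n) ≤ rho D (2 * (2 * K) * n) := rho_mono D (by nlinarith)
    have h2 : 2 * K * n * rho D (2 * K * n) ≤ 2 * K * n * rho D (2 * (2 * K) * n) :=
      Nat.mul_le_mul_left _ h1
    have h3 : ((2 * K * n * rho D (2 * K * n) : ℕ) : ℝ) ≤
        ((2 * K * n * rho D (2 * (2 * K) * n) : ℕ) : ℝ) := by exact_mod_cast h2
    push_cast at h3 ⊢
    linarith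
  -- Evaluating `hlow` at `12 * n` cancels its factor `12`.
  · refine ⟨1, K' * 12, one_pos, by omega, fun n hn => ?_⟩
    have hn' : 1 ≤ K' * 12 * n := Nat.mul_pos (by omega) hn
    dsimp only
    rw [one_mul, ← Real.le_log_iff_exp_le (by exact_mod_cast hpos _ hn')]
    have h1 := hlow (12 * n) (by omega)
    rw [← mul_assoc] at h1
    have h2 : n * rho D n ≤ n * rho D (12 * n) :=
      Nat.mul_le_mul_left _ (rho_mono D (by omega))
    have h3 : ((n * rho D n : ℕ) : ℝ) ≤ ((n * rho D (12 * n) : ℕ) : ℝ) := by exact_mod_cast h2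
    push_cast at h1 h3
    linarith

theorem exp_tau_le_Fol_GDk (D : Set ℕ) (k : ℕ → ℕ+) {n : ℕ} (hn : 2 ≤ n) :
    Real.exp (1 / 1000 * n + 1 / 1000 * tau D k (1 / 1000 * n)) ≤ (Fol (stdGen D k) n : ℝ) := by
  have h := isShiftQuotient_GDk D k
  have h2 : 2 ≤ Fol (stdGen D k) n := h.two_le_Fol hn
  have h2' : (2 : ℝ) ≤ Fol (stdGen D k) n := by exact_mod_cast h2
  have hlog2 := Real.log_two_gt_d9
  rw [← Real.le_log_iff_exp_le (by linarith)]
  -- For `n < 32` the general bound is empty, but `tau` vanishes and `Fol ≥ 2` suffices. Otherwise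
  -- `n / 32 ≥ n / 64` as reals after rounding down, and `log 2 / (8 * 64) > 1 / 1000`.
  rcases Nat.eq_zero_or_pos (n / 32) with h0 | h0
  · have hn32 : (n : ℝ) < 32 := by
      have : n < 32 := by omega
      exact_mod_cast this
    have htau : tau D k (1 / 1000 * n) = 0 := by
      have hfl : ⌊(1 / 1000 * n : ℝ)⌋₊ = 0 := by
        rw [Nat.floor_eq_zero]
        linarith
      rw [tau, hfl]
      simp
    have hlog := Real.log_le_log two_pos h2'
    rw [htau]
    linarith
  · have h1 : ((n / 32 : ℕ) + ((pairs D (fun j => (k j : ℕ)) (n / 32)).card : ℝ)) * Real.log 2 ≤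
        8 * Real.log (Fol (stdGen D k) n) :=
      h.le_log_Fol (L := n / 32) (n := n) (by omega) (by omega)
    rw [card_pairs_eq_tau] at h1
    have hn64 : (n : ℝ) ≤ 64 * (n / 32 : ℕ) := by
      have : n ≤ 64 * (n / 32) := by omega
      exact_mod_cast this
    have ht : tau D k (1 / 1000 * n) ≤ tau D k (n / 32 : ℕ) := tau_mono D k (by
      have : (0 : ℝ) ≤ n := Nat.cast_nonneg n
      linarith)
    have ht0 : 0 ≤ tau D k (n / 32 : ℕ) := by
      rw [← card_pairs_eq_tau]
      positivity
    have h3 := mul_le_mul_of_nonneg_left hlog2.le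
      (add_nonneg (Nat.cast_nonneg (n / 32) : (0 : ℝ) ≤ _) ht0)
    linarith

theorem Fol_GDk_le (D : Set ℕ) (k : ℕ → ℕ+) {n : ℕ} (hn : 1 ≤ n) :
    (Fol (stdGen D k) n : ℝ) ≤ Real.exp (4 * n + 2 * tau D k (2 * n)) := by
  have h := (isShiftQuotient_GDk D k).Fol_le hn
  rw [card_pairs_eq_tau] at h
  exact_mod_cast h

/-! ### Realization of prescribed functions -/

/-- The indices at which an integer sequence does not change, together with `0` and `1`. -/
def stationary (f : ℕ → ℤ) : Set ℕ := {j | j ≤ 1 ∨ f j = f (j - 1)}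

/-- The sum telescopes, the omitted increments beyond index `1` being zero. Index `1` is omitted
because `f 0` is unconstrained in the applications. -/
theorem sum_ite_stationary (f : ℕ → ℤ) [DecidablePred (· ∉ stationary f)] {n : ℕ} (hn : 1 ≤ n) :
    (∑ j ∈ Finset.Icc 1 n, if j ∉ stationary f then f j - f (j - 1) else 0) = f n - f 1 := by
  induction n, hn using Nat.le_induction with
  | base =>
    rw [Finset.Icc_self, Finset.sum_singleton, if_neg (not_not.2 (show 1 ∈ stationary f from Or.inl le_rfl)), sub_self]
  | succ n hn ih =>
    rw [Finset.sum_Icc_succ_top (by omega), ih, Nat.add_sub_cancel]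
    split_ifs with h
    · rcases h with h | h
      · omega
      · rw [Nat.add_sub_cancel] at h
        omega
    · ring

theorem rho_stationary {f : ℕ → ℤ} (hf : ∀ n, 1 ≤ n → f n ≤ f (n + 1))
    (hf' : ∀ n, 1 ≤ n → f (n + 1) ≤ f n + 1) {n : ℕ} (hn : 1 ≤ n) :
    (rho (stationary f) n : ℤ) = f n - f 1 := by
  classical
  rw [← sum_ite_stationary f hn, rho, Finset.card_filter, Nat.cast_sum]
  refine Finset.sum_congr rfl fun j _ => ?_
  split_ifs with h
  · rfl
  · obtain ⟨h1, h2⟩ := not_or.1 h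
    obtain ⟨i, rfl⟩ := Nat.exists_eq_succ_of_ne_zero (n := j) (by omega)
    have h3 := hf i (by omega)
    have h4 := hf' i (by omega)
    simp only [Nat.succ_eq_add_one, Nat.add_sub_cancel] at h2 ⊢
    omega

/-- The increments of an integer sequence, as periods. -/
def increments (f : ℕ → ℤ) (j : ℕ) : ℕ+ := (f j - f (j - 1)).toNat.toPNat'

theorem tau_increments {f : ℕ → ℤ} (hf : ∀ n, 1 ≤ n → f n ≤ f (n + 1))
    (hf' : ∀ n : ℕ, 1 ≤ n → f (n + 1) ≤ f n + n) {n : ℕ} (hn : 1 ≤ n) :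
    tau (stationary f) (increments f) n = f n - f 1 := by
  classical
  rw [← Int.cast_sub, ← sum_ite_stationary f hn, tau, Nat.floor_natCast, Finset.sum_filter,
    Int.cast_sum]
  refine Finset.sum_congr rfl fun j hj => ?_
  split_ifs with h
  · simp
  · obtain ⟨h1, h2⟩ := not_or.1 h
    rw [Finset.mem_Icc] at hj
    obtain ⟨i, rfl⟩ := Nat.exists_eq_succ_of_ne_zero (n := j) (by omega)
    have h3 := hf i (by omega)
    have h4 := hf' i (by omega)
    simp only [increments, Nat.succ_eq_add_one, Nat.add_sub_cancel] at h2 ⊢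
    -- The increment is positive here; the default `1` of `toPNat'` occurs only where the index is
    -- in `D` and does not count. As the increment is at most `i < n`, the minimum in `tau` is the
    -- increment.
    have h5 : ((f (i + 1) - f i).toNat.toPNat' : ℕ) = (f (i + 1) - f i).toNat := by
      rw [Nat.toPNat'_coe, if_pos (by omega)]
    rw [h5, ← Nat.cast_min, min_eq_left (by omega), ← Int.cast_natCast, Int.toNat_of_nonneg
      (by omega)]

theorem exists_asympEquiv_Fol_GD {ρ : ℕ → ℝ} (h0 : ∀ n, 1 ≤ n → 0 ≤ ρ n)
    (h1 : ∀ n, 1 ≤ n → ρ n ≤ ρ (n + 1)) (h2 : ∀ n, 1 ≤ n → ρ (n + 1) - ρ n ≤ 1) :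
    ∃ D : Set ℕ, ∀ S : Set (GD D), S.Finite → Subgroup.closure S = ⊤ →
      AsympEquiv (fun n => (Fol S n : ℝ)) (fun n => Real.exp ((n : ℝ) * ρ n + (n : ℝ))) := by
  set f : ℕ → ℤ := fun n => ⌊ρ n⌋ with hf
  have hrho : ∀ n, 1 ≤ n → (rho (stationary f) n : ℝ) = ⌊ρ n⌋ - ⌊ρ 1⌋ := by
    intro n hn
    have := rho_stationary (f := f) (fun n hn => Int.floor_mono (h1 n hn))
      (fun n hn => by
        rw [hf, ← Int.floor_add_one]
        exact Int.floor_mono (by linarith [h2 n hn])) hn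
    exact_mod_cast this
  -- `c` covers the initial value lost by telescoping and the rounding error.
  obtain ⟨c, hc⟩ := exists_nat_ge (ρ 1 + 1)
  have hfl : (0 : ℝ) ≤ ⌊ρ 1⌋ := by exact_mod_cast Int.floor_nonneg.2 (h0 1 le_rfl)
  have hfl' := Int.floor_le (ρ 1)
  refine ⟨stationary f, fun S hS hS' => (asympEquiv_Fol_GD _ hS hS').trans ⟨?_, ?_⟩⟩
  · refine asympLE_exp_of_le_add (c := c) h0 h1 fun n hn => ?_
    rw [hrho n hn]
    have := Int.floor_le (ρ n)
    have := h0 1 le_rfl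
    linarith
  · refine asympLE_exp_of_le_add (c := c) (g := fun n => (rho (stationary f) n : ℝ))
      (fun n _ => Nat.cast_nonneg _) (fun n _ => ?_) fun n hn => ?_
    · exact_mod_cast rho_mono _ (Nat.le_succ n)
    · simp only [hrho n hn]
      have := Int.lt_floor_add_one (ρ n)
      linarith

theorem exists_asympEquiv_log_Fol_GDk {τ : ℕ → ℝ} (h1 : ∀ n, 1 ≤ n → τ n ≤ τ (n + 1))
    (h2 : ∀ n : ℕ, 1 ≤ n → τ (n + 1) - τ n ≤ (n : ℝ)) :
    ∃ (D : Set ℕ) (k : ℕ → ℕ+), ∀ S : Set (GDk D k), S.Finite → Subgroup.closure S = ⊤ →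
      AsympEquiv (fun n => (n : ℝ) + τ n) (fun n => Real.log (Fol S n : ℝ)) := by
  set f : ℕ → ℤ := fun n => ⌊τ n⌋ with hf
  have htau : ∀ n : ℕ, 1 ≤ n → tau (stationary f) (increments f) n = ⌊τ n⌋ - ⌊τ 1⌋ :=
    fun n hn => tau_increments (f := f) (fun n hn => Int.floor_mono (h1 n hn))
      (fun n hn => by
        rw [hf, ← Int.floor_add_natCast]
        exact Int.floor_mono (by linarith [h2 n hn])) hn
  obtain ⟨c, hc⟩ := exists_nat_ge (|τ 1| + 1)
  have hc1 := le_abs_self (τ 1)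
  have hc2 := neg_abs_le (τ 1)
  have hfl := Int.floor_le (τ 1)
  have hfl' := Int.lt_floor_add_one (τ 1)
  have hle : ∀ n : ℕ, 1 ≤ n → tau (stationary f) (increments f) n ≤ τ n + c := fun n hn => by
    rw [htau n hn]
    have := Int.floor_le (τ n)
    linarith
  have hge : ∀ n : ℕ, 1 ≤ n → τ n ≤ tau (stationary f) (increments f) n + c := fun n hn => by
    rw [htau n hn]
    have := Int.lt_floor_add_one (τ n)
    linarith
  refine ⟨stationary f, increments f, fun S hS hS' => ?_⟩
  obtain ⟨-, ⟨K, hK, hup⟩, ⟨K', hK', hlow⟩⟩ :=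
    (isShiftQuotient_GDk (stationary f) (increments f)).exists_log_Fol_bounds hS hS'
  simp only [card_pairs_eq_tau] at hup hlow
  constructor
  -- At the argument `(c + 1) * n` the linear term exceeds `n` by `c * n ≥ c`, which pays for the
  -- additive error.
  · refine ⟨12, K' * (c + 1), by norm_num, Nat.mul_pos hK' (Nat.succ_pos c), fun n hn => ?_⟩
    have hm : n ≤ (c + 1) * n := Nat.le_mul_of_pos_left n (Nat.succ_pos c)
    have e1 := hlow ((c + 1) * n) (hn.trans hm)
    have e2 := hge ((c + 1) * n) (hn.trans hm)
    have e3 := le_of_forall_le_succ h1 hn hm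
    have e4 : (c : ℝ) ≤ c * n := le_mul_of_one_le_right (Nat.cast_nonneg c) (by exact_mod_cast hn)
    rw [← mul_assoc] at e1
    push_cast at e1 e2
    linarith
  · refine ⟨2, 2 * K + c, by norm_num, by omega, fun n hn => ?_⟩
    have hm : 1 ≤ 2 * K * n := Nat.mul_pos (by omega) hn
    have hm' : 2 * K * n ≤ (2 * K + c) * n := Nat.mul_le_mul_right n (Nat.le_add_right _ _)
    have e1 := hup n hn
    have e2 := hle (2 * K * n) hm
    have e3 := le_of_forall_le_succ h1 hm hm'
    have e4 : (c : ℝ) ≤ c * n := le_mul_of_one_le_right (Nat.cast_nonneg c) (by exact_mod_cast hn)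
    push_cast at e1 e2 ⊢
    linarith

end

end NilByCyclic

open NilByCyclic in
theorem mainTheorem4 :
    -- the Følner function of `G_{D,2}`
    (∀ (D : Set ℕ) (S : Set (GD D)), S.Finite → Subgroup.closure S = ⊤ →
      AsympEquiv (fun n => (Fol S n : ℝ))
        (fun n => Real.exp ((n : ℝ) * (rho D n : ℝ) + (n : ℝ)))) ∧
    -- realization
    (∀ ρ : ℕ → ℝ, (∀ n, 1 ≤ n → 0 ≤ ρ n) → (∀ n, 1 ≤ n → ρ n ≤ ρ (n + 1)) →
      (∀ n, 1 ≤ n → ρ (n + 1) - ρ n ≤ 1) →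
      ∃ D : Set ℕ, ∀ S : Set (GD D), S.Finite → Subgroup.closure S = ⊤ →
        AsympEquiv (fun n => (Fol S n : ℝ))
          (fun n => Real.exp ((n : ℝ) * ρ n + (n : ℝ)))) ∧
    -- lower bound for `G_{D,2,k}`
    (∃ C : ℝ, 0 < C ∧ ∀ (D : Set ℕ) (k : ℕ → ℕ+) (n : ℕ), 2 ≤ n →
      Real.exp (C * n + C * tau D k (C * n)) ≤ (Fol (stdGen D k) n : ℝ)) ∧
    -- upper bound for `G_{D,2,k}`
    (∀ (D : Set ℕ) (k : ℕ → ℕ+) (n : ℕ), 1 ≤ n →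
      (Fol (stdGen D k) n : ℝ) ≤ Real.exp (4 * n + 2 * tau D k (2 * n))) ∧
    -- realization
    (∀ τ : ℕ → ℝ, (∀ n, 1 ≤ n → τ n ≤ τ (n + 1)) →
      (∀ n : ℕ, 1 ≤ n → τ (n + 1) - τ n ≤ (n : ℝ)) →
      ∃ (D : Set ℕ) (k : ℕ → ℕ+), ∀ S : Set (GDk D k), S.Finite → Subgroup.closure S = ⊤ →
        AsympEquiv (fun n => (n : ℝ) + τ n) (fun n => Real.log (Fol S n : ℝ))) := by
  refine ⟨fun D S hS hS' => asympEquiv_Fol_GD D hS hS',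
    fun ρ h0 h1 h2 => exists_asympEquiv_Fol_GD h0 h1 h2,
    ⟨1 / 1000, by norm_num, fun D k n hn => exp_tau_le_Fol_GDk D k hn⟩,
    fun D k n hn => Fol_GDk_le D k hn,
    fun τ h1 h2 => exists_asympEquiv_log_Fol_GDk h1 h2⟩
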